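/- **Fatgraphs and the chromatic complex.** Let $F$ be a fatgraph: a finite graph (loops, multiple edges and several components allowed) with a cyclic order on the half-edges at each vertex. It gives an oriented surface made of discs (islands, one for each vertex) and untwisted bands (bridges, one for each edge). Let $v$ and $e(F)$ be its numbers of vertices and bridges, label the bridges by a linearly ordered set, and assume that $F$ has genus $0$. A state is the spanning fatsubgraph $H$ obtained by removing a set $A$ of bridges; its height is $h=|A|$; let $p(H)$ be the number of boundary components of its surface and $2g(H)=k(H)-p(H)+n(H)$ twice its genus ($k$ the number of components, $n$ the nullity). Let $V$ be the free graded $\mathbb Z$-module on $v_+,v_-$ in degrees $1,-1$ and $R$ the one on $x_0,x_{-2}$ in degrees $0,-2$; $M\{l\}_m=M_{m-l}$, and $M_p$ is the degree $p$ part of $M$. Define $\bar\vartriangle:R^{\otimes h}\to R^{\otimes(h+1)}$ by $1\mapsto x_0$ for $h=0$ and $y\otimes x_i\mapsto y\otimes\sum_{k+l=i}x_k\otimes x_l$ for $h\ge1$, and put $\bar\vartriangle R^{\otimes(-1)}=0$. The unnormalised chromatic complex $\widetilde{\mathcal C}(F)$ has $$\widetilde{\mathcal C}^i(F)=\bigoplus_{H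 \text{ of height } i}V^{\otimes(v+p(H)+2g(H))}\otimes R^{\otimes i}\{i\}.$$ Its differential is the sum, over all removals of one more bridge $e$ from a state, of $(-1)^{\#\{a\in A:\,a<e\}}$ times the tensor product of: the identity of $V^{\otimes v}$; on $V^{\otimes p}$, the product $v_+v_+=v_+$, $v_+v_-=v_-v_+=v_-$, $v_-v_-=0$ if two boundary components merge, or the coproduct $v_+\mapsto v_+\otimes v_-+v_-\otimes v_+$, $v_-\mapsto v_-\otimes v_-$ if one splits (the identity on the other factors); on $V^{\otimes 2g}$, the identity if $g$ is unchanged, and otherwise the map that sends a basis element to the sum of all basis elements of the same degree; and $\bar\vartriangle$ on $R^{\otimes h}$. The chromatic complex is $\mathcal C(F)=\widetilde{\mathcal C}(F)[-e(F)]$, where $(\mathcal C[s])^i=\mathcal C^{i-s}$. **The associated link.** Let $L\subset S^3$ be the alternating link associated with $F$, given by the diagram that has one crossing on every bridge, whose 0-smoothing follows the two sides of the bridge and whose 1-smoothing cuts the bridge, the crossings being connected along the boundaries of the islands (a vertex without half-edges gives a component without crossings). Give $L$ an arbitrary orientation, and let $n_\pm$ be the number of its $\pm$-crossings. For a state $S$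 of the diagram let $h(S)$ be its number of 1-smoothings and $p(S)$ its number of cycles. The unnormalised Khovanov complex $\widetilde{\mathcal C}(L)$ has $\widetilde{\mathcal C}^i(L)=\bigoplus_{h(S)=i}V^{\otimes p(S)}\{i\}$, with the differential $\widetilde d$ given by the same product, coproduct and signs; let $\widetilde{HK}(L)$ be its homology and $Z^i_p(L)=\ker(\widetilde d^{\,i}_p)$ its cycles. The Khovanov complex is $\mathcal C(L)=\widetilde{\mathcal C}(L)[-n_-]\{n_+-2n_-\}$, with differential $d$; its homology $HK(L)$ is Khovanov homology. **Theorem.** For every integer $i\ge0$ and every $j\in\mathbb Z$ there is an isomorphism of abelian groups $$H^i_j\bigl(\widetilde{\mathcal C}(F)\bigr)\cong\bigoplus_{p+q+r=j}\Bigl(\bigl(\widetilde{HK}{}^i_p(L)\otimes\bar\vartriangle R^{\otimes(i-1)}_q\bigr)\oplus\bigl(Z^i_p(L)\otimes R^{\otimes i}_q/\bar\vartriangle R^{\otimes(i-1)}_q\bigr)\Bigr)\otimes V^{\otimes v}_r .$$ Here, for all $i,p\in\mathbb Z$, $$\widetilde{HK}{}^i_p(L)\cong HK^{\,i-n_-}_{\,p+n_+-2n_-}(L),\qquad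 Z^i_p(L)=\ker\bigl(d^{\,i-n_-}_{\,p+n_+-2n_-}\bigr).$$ Moreover $H^i_j(\mathcal C(F))\cong H^{i+e(F)}_j(\widetilde{\mathcal C}(F))$ for all $i,j\in\mathbb Z$. -/

import Mathlib

open scoped TensorProduct DirectSum

noncomputable section

/-! ### Based bigraded complexes -/

/-- A finitely generated free bigraded `ℤ`-module, given by a finite basis `Gen` whose elements have
a height and a degree, with an endomorphism `∂` given on the basis by an integer matrix:
`coeff x y` is the coefficient of `y` in `∂ x`. -/
structure BasedComplex where
  Gen : Type*
  [finite : Finite Gen]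
  height : Gen → ℤ
  deg : Gen → ℤ
  coeff : Gen → Gen → ℤ

namespace BasedComplex

attribute [instance] BasedComplex.finite

/-- The underlying free module, the sum of all the chain groups. -/
abbrev Total (C : BasedComplex) : Type _ := C.Gen →₀ ℤ

/-- The differential on the sum of all the chain groups. -/
def d (C : BasedComplex) : C.Total →ₗ[ℤ] C.Total :=
  Finsupp.linearCombination ℤ fun x => Finsupp.equivFunOnFinite.symm (C.coeff x)

/-- The part `C^i_j` of height `i` and degree `j`. -/
def part (C : BasedComplex) (i j : ℤ) : Submodule ℤ C.Total :=
  Finsupp.supported ℤ ℤ {x | C.height x = i ∧ C.deg x = j}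

/-- The cycles `Z^i_j`, the kernel of `∂` on `C^i_j`. -/
def cycles (C : BasedComplex) (i j : ℤ) : Submodule ℤ C.Total :=
  LinearMap.ker C.d ⊓ C.part i j

/-- The boundaries, the image of `C^{i-1}_j` under `∂`. -/
def boundaries (C : BasedComplex) (i j : ℤ) : Submodule ℤ C.Total :=
  (C.part (i - 1) j).map C.d

/-- The homology `H^i_j`, cycles modulo boundaries. -/
abbrev Homology (C : BasedComplex) (i j : ℤ) : Type _ :=
  C.cycles i j ⧸ (C.boundaries i j).submoduleOf (C.cycles i j)

/-- The shifted complex `C[s]{l}`, with `C[s]{l}^i_j = C^{i-s}_{j-l}`. -/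
def shift (C : BasedComplex) (s l : ℤ) : BasedComplex where
  Gen := C.Gen
  height x := C.height x + s
  deg x := C.deg x + l
  coeff := C.coeff

end BasedComplex

/-! ### The graded modules `V` and `R`, and their tensor powers

`V` is free on `v₊`, `v₋` (written `true`, `false`) in degrees `1`, `-1`, and `R` is free on
`x₀`, `x₋₂` (written `true`, `false`) in degrees `0`, `-2`. The tensor power of either one over a
finite index type `ι` is free on the functions `ι → Bool` (the pure tensors of basis elements). -/

/-- The degree of a basis element of `V`. -/
def vDeg (b : Bool) : ℤ := if b then 1 else -1

/-- The degree of a basis element of `R`. -/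
def rDeg (b : Bool) : ℤ := if b then 0 else -2

/-- The degree of a basis element of `V^{⊗ι}`. -/
def vPowDeg {ι : Type*} (s : ι → Bool) : ℤ := ∑ᶠ i, vDeg (s i)

/-- The degree of a basis element of `R^{⊗ι}`. -/
def rPowDeg {ι : Type*} (s : ι → Bool) : ℤ := ∑ᶠ i, rDeg (s i)

/-- The degree `r` part of `V^{⊗ι}`. -/
def vPart (ι : Type*) (r : ℤ) : Submodule ℤ ((ι → Bool) →₀ ℤ) :=
  Finsupp.supported ℤ ℤ {s | vPowDeg s = r}

/-- The degree `q` part of `R^{⊗h}`. -/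
def rPart (h : ℕ) (q : ℤ) : Submodule ℤ ((Fin h → Bool) →₀ ℤ) :=
  Finsupp.supported ℤ ℤ {s | rPowDeg s = q}

/-- The coefficient of `w` in the image of `u` under `Δ̄_h : R^{⊗h} → R^{⊗(h+1)}`, where
`Δ̄_0 1 = x₀` and `Δ̄_h (y ⊗ x_i) = y ⊗ ∑_{k+l=i} x_k ⊗ x_l`. -/
def rDeltaCoeff : (h : ℕ) → (Fin h → Bool) → (Fin (h + 1) → Bool) → ℤ
  | 0, _, w => if w 0 = true then 1 else 0
  | h + 1, u, w =>
    if (∀ k : Fin h, w k.castSucc.castSucc = u k.castSucc) ∧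
        rDeg (w (Fin.last h).castSucc) + rDeg (w (Fin.last (h + 1))) = rDeg (u (Fin.last h))
    then 1 else 0

/-- The map `Δ̄_h : R^{⊗h} → R^{⊗(h+1)}`. -/
def rDelta (h : ℕ) : ((Fin h → Bool) →₀ ℤ) →ₗ[ℤ] ((Fin (h + 1) → Bool) →₀ ℤ) :=
  Finsupp.linearCombination ℤ fun u => Finsupp.equivFunOnFinite.symm (rDeltaCoeff h u)

/-- `Δ̄ R^{⊗(i-1)}_q`, a submodule of `R^{⊗i}`; it is zero for `i = 0`. -/
def rDeltaImage : (i : ℕ) → ℤ → Submodule ℤ ((Fin i → Bool) →₀ ℤ)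
  | 0, _ => ⊥
  | i + 1, q => (rPart i q).map (rDelta i)

/-- The quotient `R^{⊗i}_q / Δ̄ R^{⊗(i-1)}_q`. -/
abbrev RQuot (i : ℕ) (q : ℤ) : Type :=
  rPart i q ⧸ (rDeltaImage i q).submoduleOf (rPart i q)

/-- The coefficient of `v_c` in the product of `v_a` and `v_b`:
`v₊v₊ = v₊`, `v₊v₋ = v₋v₊ = v₋`, `v₋v₋ = 0`. -/
def mulCoeff : Bool → Bool → Bool → ℤ
  | true, true, true => 1
  | true, false, false => 1
  | false, true, false => 1
  | _, _, _ => 0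

/-- The coefficient of `v_a ⊗ v_b` in the coproduct of `v_c`:
`v₊ ↦ v₊ ⊗ v₋ + v₋ ⊗ v₊`, `v₋ ↦ v₋ ⊗ v₋`. -/
def comulCoeff : Bool → Bool → Bool → ℤ
  | true, true, false => 1
  | true, false, true => 1
  | false, false, false => 1
  | _, _, _ => 0

open Classical in
/-- The matrix coefficient, between the basis elements `s` and `s'`, of the map
`V^{⊗(C ⊕ O)} → V^{⊗(C' ⊕ O)}` induced by a surgery that merges two closed curves or splits one.
The curves before and after the surgery are `C ⊕ O` and `C' ⊕ O`; those in `O` are never touched.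
The curves in `C` and `C'` are made of arcs `t : T`, and `c t`, `c' t` are the curves on which `t`
lies before and after. The arcs `a` and `b` are on the curve(s) touched by the surgery: these are
`c a` and `c b` before, and `c' a` and `c' b` after. The map is the identity on the factors of the
other curves; if `c a = c b`, this curve is split and the map is the coproduct on its factor;
otherwise `c a` and `c b` are merged and the map is the product on their factors. -/
def surgeryCoeff {T C C' O : Type*} (c : T → C) (c' : T → C') (a b : T)
    (s : C ⊕ O → Bool) (s' : C' ⊕ O → Bool) : ℤ :=
  if (∀ o, s' (Sum.inr o) = s (Sum.inr o)) ∧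
      ∀ t, c t ≠ c a → c t ≠ c b → s' (Sum.inl (c' t)) = s (Sum.inl (c t)) then
    if c a = c b then
      comulCoeff (s (Sum.inl (c a))) (s' (Sum.inl (c' a))) (s' (Sum.inl (c' b)))
    else mulCoeff (s (Sum.inl (c a))) (s (Sum.inl (c b))) (s' (Sum.inl (c' a)))
  else 0

/-- The sign `(-1)^{∑_{i<e} α_i}` of the edge of the cube that starts at the vertex `α`, the
indicator function of `A`, and changes the coordinate `e`. -/
def cubeSign {E : Type*} [LinearOrder E] (A : Finset E) (e : E) : ℤ :=
  (-1) ^ (A.filter (· < e)).card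

/-! ### Fatgraphs -/

/-- A fatgraph with vertex set `V` and edge set `E`, loops and multiple edges allowed. The two
half-edges of the edge `e` are `(e, false)` and `(e, true)`. The cyclic order at a vertex is the
restriction of `rot` to its half-edges, of which it is a single cycle (`rot d` is the half-edge that
follows `d`). A vertex may have no half-edges. -/
structure Fatgraph (V E : Type*) where
  vert : E × Bool → V
  rot : Equiv.Perm (E × Bool)
  sameCycle_iff : ∀ d d', rot.SameCycle d d' ↔ vert d = vert d'

namespace Fatgraph

variable {V E : Type*}

/-- The vertices of `F` without half-edges. -/
abbrev Isolated (F : Fatgraph V E) : Type _ := {v : V // ∀ d, F.vert d ≠ v}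

section

variable [LinearOrder E]

/-- Passing along the bridges that are kept when those in `A` are removed: a half-edge of a bridge
that is kept goes to the other half-edge of this bridge, the other half-edges are fixed. -/
def bridgePerm (A : Finset E) : Equiv.Perm (E × Bool) :=
  Function.Involutive.toPerm (fun d => if d.1 ∈ A then d else (d.1, !d.2)) (by
    rintro ⟨e, b⟩
    by_cases h : e ∈ A <;> simp [h])

/-- The half-edges cut the boundary of their island into arcs; the arc `d` is the one from the
half-edge `d` to the half-edge `rot d`. `bdryPerm A d` is the arc that follows `d` on the boundary
of the surface of the state obtained by removing the bridges in `A`: at the half-edge `rot d` the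
boundary runs along the bridge to the other end, or, if the bridge is removed, continues along the
same island. -/
def bdryPerm (F : Fatgraph V E) (A : Finset E) : Equiv.Perm (E × Bool) :=
  F.rot.trans (bridgePerm A)

/-- The boundary components that contain arcs. -/
abbrev Curve (F : Fatgraph V E) (A : Finset E) : Type _ :=
  Quotient (Equiv.Perm.SameCycle.setoid (F.bdryPerm A))

/-- The boundary component of an arc. -/
def curve (F : Fatgraph V E) (A : Finset E) (d : E × Bool) : F.Curve A :=
  Quotient.mk (Equiv.Perm.SameCycle.setoid (F.bdryPerm A)) d

/-- The boundary components of the state obtained by removing the bridges in `A`; the islands of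
vertices that have no half-edges in `F` contribute one each. -/
abbrev Bdry (F : Fatgraph V E) (A : Finset E) : Type _ := F.Curve A ⊕ F.Isolated

/-- The number `p` of boundary components of a state. -/
def numBdry (F : Fatgraph V E) (A : Finset E) : ℕ := Nat.card (F.Bdry A)

/-- The number `k` of connected components of a state. -/
def numComp (F : Fatgraph V E) (A : Finset E) : ℕ :=
  Nat.card (Quot fun v w : V => ∃ e ∉ A, v = F.vert (e, false) ∧ w = F.vert (e, true))

/-- The rank `r = |V| - k` of a state. -/
def rank (F : Fatgraph V E) (A : Finset E) : ℤ := Nat.card V - F.numComp A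

/-- The nullity `n = |E(H)| - r` of a state `H`. -/
def nullity (F : Fatgraph V E) (A : Finset E) : ℤ := (Nat.card E - A.card) - F.rank A

/-- Twice the genus of the surface of a state, `2g = k - p + n`. -/
def twoGenus (F : Fatgraph V E) (A : Finset E) : ℤ := F.numComp A - F.numBdry A + F.nullity A

/-- The fatgraph has genus zero. -/
def IsGenusZero (F : Fatgraph V E) : Prop := F.twoGenus ∅ = 0

/-- The basis of `⨁_A V^{⊗v} ⊗ V^{⊗p} ⊗ V^{⊗2g} ⊗ R^{⊗h}`, where `A` runs over all sets of removed
bridges and `h = |A|`. -/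
abbrev Gen (F : Fatgraph V E) : Type _ :=
  (A : Finset E) × (V → Bool) × (F.Bdry A → Bool) × (Fin (F.twoGenus A).toNat → Bool) ×
    (Fin A.card → Bool)

open Classical in
/-- The matrix coefficient of the map `V^{⊗m} → V^{⊗m'}` of the genus factors: the identity if
`m = m'`, and otherwise the map that sends a basis element to the sum of all the basis elements of
the same degree. -/
def genusCoeff {m m' : ℕ} (t : Fin m → Bool) (t' : Fin m' → Bool) : ℤ :=
  if h : m' = m then if t' = t ∘ Fin.cast h then 1 else 0
  else if vPowDeg t' = vPowDeg t then 1 else 0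

/-- The matrix coefficient of `Δ̄_h : R^{⊗h} → R^{⊗h'}` where `h' = h + 1`. -/
def rCoeff {h h' : ℕ} (u : Fin h → Bool) (w : Fin h' → Bool) : ℤ :=
  if e : h' = h + 1 then rDeltaCoeff h u (w ∘ Fin.cast e.symm) else 0

open Classical in
/-- The unnormalised chromatic complex `C̃(F)`. -/
def chromaticComplexTilde [Finite V] [Fintype E] (F : Fatgraph V E) : BasedComplex where
  Gen := F.Gen
  height := fun ⟨A, _⟩ => A.card
  deg := fun ⟨A, l, s, t, u⟩ => vPowDeg l + vPowDeg s + vPowDeg t + rPowDeg u + A.card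
  coeff := fun ⟨A, l, s, t, u⟩ ⟨A', l', s', t', u'⟩ =>
    ∑ e : E, if e ∉ A ∧ A' = insert e A then
      cubeSign A e * (if l' = l then 1 else 0) *
        surgeryCoeff (F.curve A) (F.curve A') (e, false) (e, true) s s' *
        genusCoeff t t' * rCoeff u u'
      else 0

/-- The chromatic complex `C(F) = C̃(F)[-e(F)]`. -/
def chromaticComplex [Finite V] [Fintype E] (F : Fatgraph V E) : BasedComplex :=
  F.chromaticComplexTilde.shift (-(Fintype.card E : ℤ)) 0

end

end Fatgraph

/-! ### Link diagrams and Khovanov homology -/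

/-- The next strand end at the same crossing, counterclockwise. -/
def endRot (X : Type*) : Equiv.Perm (X × Fin 4) :=
  Equiv.prodCongr (Equiv.refl X) (Equiv.addRight 1)

/-- An unoriented link diagram on the sphere with crossings `X` and a set `O` of components without
crossings. The four strand ends at the crossing `x` are `(x, 0)`, `(x, 1)`, `(x, 2)`, `(x, 3)` in
counterclockwise order; `(x, 0)` and `(x, 2)` are the ends of the lower strand, `(x, 1)` and
`(x, 3)` those of the upper strand. The arcs of the diagram join every strand end `t` to the strand
end `join t`. -/
structure LinkDiagram (X O : Type*) where
  join : Equiv.Perm (X × Fin 4)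
  join_join : ∀ t, join (join t) = t
  join_ne : ∀ t, join t ≠ t
  /-- Euler's formula for the underlying 4-valent graph, which has `|X|` vertices and `2|X|` edges:
  the number of faces is `|X|` plus twice the number of connected components. -/
  planar : Nat.card (Quotient (Equiv.Perm.SameCycle.setoid ((endRot X).trans join))) =
    Nat.card X + 2 * Nat.card (Quot fun x y : X => ∃ i j, join (x, i) = (y, j))

namespace LinkDiagram

variable {X O : Type*}

/-- An orientation of the diagram: it says which strand ends are directed towards their crossing.
(The orientations of the components without crossings play no role.) -/
structure Orientation (L : LinkDiagram X O) where
  inward : X × Fin 4 → Bool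
  inward_join : ∀ t, inward (L.join t) = !inward t
  inward_opposite : ∀ x i, inward (x, i + 2) = !inward (x, i)

/-- The number `n₊` of positive crossings; a crossing is positive if the directed upper strand is
turned into the directed lower strand by a counterclockwise quarter turn. -/
def Orientation.nPos {L : LinkDiagram X O} (o : L.Orientation) : ℕ :=
  Nat.card {x : X // o.inward (x, 0) = o.inward (x, 3)}

/-- The number `n₋` of negative crossings. -/
def Orientation.nNeg {L : LinkDiagram X O} (o : L.Orientation) : ℕ :=
  Nat.card {x : X // o.inward (x, 0) ≠ o.inward (x, 3)}

variable [LinearOrder X]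

/-- The strand end that is connected to a given one when the crossings in `A` are 1-smoothed and the
others are 0-smoothed. The 0-smoothing connects `0` with `1` and `2` with `3`; it opens the channel
between the two regions swept out when the upper strand is turned counterclockwise. The 1-smoothing
connects `0` with `3` and `1` with `2`. -/
def smooth (A : Finset X) (t : X × Fin 4) : X × Fin 4 :=
  if t.1 ∈ A then (t.1, ![3, 2, 1, 0] t.2) else (t.1, ![1, 0, 3, 2] t.2)

/-- The cycles through strand ends in the state of the diagram given by `A`. -/
abbrev Curve (L : LinkDiagram X O) (A : Finset X) : Type _ :=
  Quot fun t t' => t' = L.join t ∨ t' = smooth A t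

/-- The cycle on which a strand end lies. -/
def curve (L : LinkDiagram X O) (A : Finset X) (t : X × Fin 4) : L.Curve A := Quot.mk _ t

/-- All the cycles in the state of the diagram given by `A`. -/
abbrev Cycle (L : LinkDiagram X O) (A : Finset X) : Type _ := L.Curve A ⊕ O

/-- The basis of `⨁_A V^{⊗p}`, where `A` runs over all states and `p` is their number of cycles. -/
abbrev Gen (L : LinkDiagram X O) : Type _ := (A : Finset X) × (L.Cycle A → Bool)

open Classical in
/-- The unnormalised Khovanov complex `C̃(L)`. -/
def khovanovComplexTilde [Fintype X] [Finite O] (L : LinkDiagram X O) : BasedComplex where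
  Gen := L.Gen
  height := fun ⟨A, _⟩ => A.card
  deg := fun ⟨A, s⟩ => vPowDeg s + A.card
  coeff := fun ⟨A, s⟩ ⟨A', s'⟩ =>
    ∑ x : X, if x ∉ A ∧ A' = insert x A then
      cubeSign A x * surgeryCoeff (L.curve A) (L.curve A') (x, 0) (x, 2) s s' else 0

/-- The Khovanov complex `C(L) = C̃(L)[-n₋]{n₊ - 2n₋}` of an oriented diagram. -/
def khovanovComplex [Fintype X] [Finite O] (L : LinkDiagram X O) (o : L.Orientation) :
    BasedComplex :=
  L.khovanovComplexTilde.shift (-(o.nNeg : ℤ)) (o.nPos - 2 * o.nNeg)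

end LinkDiagram

/-! ### The link associated with a fatgraph of genus zero -/

theorem Fatgraph.card_cycles_conj {α β : Type*} (e : α ≃ β) (f : Equiv.Perm α) (g : Equiv.Perm β)
    (h : ∀ a, e (f a) = g (e a)) :
    Nat.card (Quotient (Equiv.Perm.SameCycle.setoid f)) =
      Nat.card (Quotient (Equiv.Perm.SameCycle.setoid g)) := by
  have hg : g = e.permCongr f := by
    ext b
    obtain ⟨a, rfl⟩ := e.surjective b
    simp [Equiv.permCongr_apply, h]
  refine Nat.card_congr (Quotient.congr e fun a b => ?_)
  change f.SameCycle a b ↔ g.SameCycle (e a) (e b)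
  have key : ∀ n : ℤ, (g ^ n) (e a) = e ((f ^ n) a) := by
    intro n
    rw [hg]
    have := (map_zpow e.permCongrHom f n)
    have h2 := congrArg (fun p => p (e a)) this
    simp at h2
    exact h2.symm
  simp [Equiv.Perm.SameCycle, key]

theorem Fatgraph.card_cycles_sum {α β : Type*} [Finite α] [Finite β] (f : Equiv.Perm α)
    (g : Equiv.Perm β) :
    Nat.card (Quotient (Equiv.Perm.SameCycle.setoid (Equiv.Perm.sumCongr f g))) =
      Nat.card (Quotient (Equiv.Perm.SameCycle.setoid f)) +
        Nat.card (Quotient (Equiv.Perm.SameCycle.setoid g)) := by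
  have key : ∀ n : ℤ, (Equiv.Perm.sumCongr f g) ^ n = Equiv.Perm.sumCongr (f ^ n) (g ^ n) := by
    intro n
    exact (map_zpow (Equiv.Perm.sumCongrHom α β) (f, g) n).symm
  rw [← Nat.card_sum]
  refine Nat.card_congr
    { toFun := Quotient.lift (Sum.map (Quotient.mk _) (Quotient.mk _)) ?_
      invFun := Sum.elim
        (Quotient.map Sum.inl ?_) (Quotient.map Sum.inr ?_)
      left_inv := ?_
      right_inv := ?_ }
  · rintro (a | a) (b | b) ⟨n, hn⟩ <;> rw [key] at hn
    · exact congrArg Sum.inl (Quotient.sound ⟨n, by simpa using hn⟩)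
    · simp at hn
    · simp at hn
    · exact congrArg Sum.inr (Quotient.sound ⟨n, by simpa using hn⟩)
  · rintro a b ⟨n, hn⟩
    exact ⟨n, by rw [key]; simpa using hn⟩
  · rintro a b ⟨n, hn⟩
    exact ⟨n, by rw [key]; simpa using hn⟩
  · rintro ⟨a | a⟩ <;> rfl
  · rintro (⟨⟨a⟩⟩ | ⟨⟨a⟩⟩) <;> rfl

namespace Fatgraph

variable {V E : Type*}

/-- The strand ends of the associated diagram. There is a crossing on every bridge, and an arc of the
diagram along every arc `d` of the boundary of an island, from the half-edge `d` (`Sum.inl d`) to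
the half-edge `rot d` (where its end is `Sum.inr (rot d)`). With the bridge `e` drawn horizontally
and its half-edge `(e, false)` on the left, the four ends at its crossing are, counterclockwise,
`0` upper right, `1` upper left, `2` lower left and `3` lower right. -/
def strandEnds (E : Type*) : (E × Bool) ⊕ (E × Bool) ≃ E × Fin 4 where
  toFun := Sum.elim (fun d => (d.1, bif d.2 then 3 else 1)) (fun d => (d.1, bif d.2 then 0 else 2))
  invFun t := ![Sum.inr (t.1, true), Sum.inl (t.1, false), Sum.inr (t.1, false),
    Sum.inl (t.1, true)] t.2
  left_inv := by rintro (⟨e, _ | _⟩ | ⟨e, _ | _⟩) <;> rfl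
  right_inv := by
    rintro ⟨e, i⟩
    fin_cases i <;> rfl

/-- The arc `d` joins its end at the half-edge `d` to its end at the half-edge `rot d`. -/
def arcSwap (F : Fatgraph V E) : Equiv.Perm ((E × Bool) ⊕ (E × Bool)) where
  toFun := Sum.elim (fun d => Sum.inr (F.rot d)) (fun d => Sum.inl (F.rot.symm d))
  invFun := Sum.elim (fun d => Sum.inr (F.rot d)) (fun d => Sum.inl (F.rot.symm d))
  left_inv := by rintro (d | d) <;> simp
  right_inv := by rintro (d | d) <;> simp

theorem card_faces [LinearOrder E] [Finite V] [Finite E] (F : Fatgraph V E) :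
    Nat.card (Quotient (Equiv.Perm.SameCycle.setoid
      ((endRot E).trans ((strandEnds E).permCongr F.arcSwap)))) + Nat.card F.Isolated =
      Nat.card (F.Curve ∅) + Nat.card V := by
  have h1 := card_cycles_conj (strandEnds E)
    (Equiv.Perm.sumCongr F.rot⁻¹ ((bridgePerm ∅).trans F.rot))
    ((endRot E).trans ((strandEnds E).permCongr F.arcSwap)) (by
      have h : ∀ t : (E × Bool) ⊕ (E × Bool), endRot E (strandEnds E t) =
          strandEnds E (Sum.elim (fun d => Sum.inr d) (fun d => Sum.inl (d.1, !d.2)) t) := by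
        rintro (⟨e, _ | _⟩ | ⟨e, _ | _⟩) <;> refine Prod.ext rfl ?_ <;>
          simp [endRot, strandEnds]
      intro t
      rw [Equiv.trans_apply, h, Equiv.permCongr_apply, Equiv.symm_apply_apply]
      rcases t with d | d
      · rfl
      · simp [arcSwap, bridgePerm, Function.Involutive.toPerm])
  rw [← h1, card_cycles_sum]
  have h2 : Nat.card (F.Curve ∅) = Nat.card (Quotient (Equiv.Perm.SameCycle.setoid
      ((bridgePerm (∅ : Finset E)).trans F.rot))) :=
    card_cycles_conj F.rot _ _ (fun a => rfl)
  rw [h2]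
  have h3 : Nat.card V = Nat.card (Quotient (Equiv.Perm.SameCycle.setoid F.rot⁻¹)) +
      Nat.card F.Isolated := by
    rw [← Nat.card_sum]
    symm
    refine Nat.card_eq_of_bijective
      (Sum.elim (Quotient.lift F.vert fun a b h => ?_) Subtype.val) ⟨?_, ?_⟩
    · exact (F.sameCycle_iff a b).1 (Equiv.Perm.sameCycle_inv.1 h)
    · rintro (a | ⟨v, hv⟩) (b | ⟨w, hw⟩) h
      · induction a using Quotient.inductionOn with | _ a
        induction b using Quotient.inductionOn with | _ b
        exact congrArg Sum.inl (Quotient.sound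
          (Equiv.Perm.sameCycle_inv.2 ((F.sameCycle_iff a b).2 h)))
      · induction a using Quotient.inductionOn with | _ a
        exact absurd h (hw a)
      · induction b using Quotient.inductionOn with | _ b
        exact absurd h.symm (hv b)
      · exact congrArg Sum.inr (Subtype.ext h)
    · intro v
      by_cases hv : ∀ d, F.vert d ≠ v
      · exact ⟨Sum.inr ⟨v, hv⟩, rfl⟩
      · push Not at hv
        obtain ⟨d, hd⟩ := hv
        exact ⟨Sum.inl (Quotient.mk _ d), hd⟩
  omega

theorem card_components [LinearOrder E] [Finite V] [Finite E] (F : Fatgraph V E) :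
    Nat.card (Quot fun x y : E => ∃ i j, (strandEnds E).permCongr F.arcSwap (x, i) = (y, j)) +
      Nat.card F.Isolated = F.numComp ∅ := by
  set r := fun x y : E => ∃ i j, (strandEnds E).permCongr F.arcSwap (x, i) = (y, j)
  have hrot : ∀ d, r d.1 (F.rot d).1 := by
    intro d
    refine ⟨(strandEnds E (Sum.inl d)).2, (strandEnds E (Sum.inr (F.rot d))).2, ?_⟩
    change (strandEnds E).permCongr F.arcSwap (strandEnds E (Sum.inl d)) =
      strandEnds E (Sum.inr (F.rot d))
    rw [Equiv.permCongr_apply, Equiv.symm_apply_apply]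
    rfl
  have hvrot : ∀ d, F.vert (F.rot d) = F.vert d := fun d =>
    ((F.sameCycle_iff _ _).1 ⟨1, by simp⟩).symm
  have hr : ∀ x y, r x y → ∃ b b', F.vert (x, b) = F.vert (y, b') := by
    rintro x y ⟨i, j, h⟩
    obtain ⟨t, ht⟩ := (strandEnds E).surjective (x, i)
    rw [← ht, Equiv.permCongr_apply, Equiv.symm_apply_apply] at h
    rcases t with ⟨e, b⟩ | ⟨e, b⟩
    · have hx : e = x := congrArg Prod.fst ht
      have hy : (F.rot (e, b)).1 = y := congrArg Prod.fst h
      subst hx hy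
      exact ⟨b, (F.rot (e, b)).2, (hvrot _).symm⟩
    · have hx : e = x := congrArg Prod.fst ht
      have hy : (F.rot.symm (e, b)).1 = y := congrArg Prod.fst h
      subst hx hy
      refine ⟨b, (F.rot.symm (e, b)).2, ?_⟩
      have := hvrot (F.rot.symm (e, b))
      simpa using this
  have hcyc : ∀ d d', F.rot.SameCycle d d' → Quot.mk r d.1 = Quot.mk r d'.1 := by
    rintro d d' h
    obtain ⟨n, rfl⟩ := h.exists_nat_pow_eq
    clear h
    induction n with
    | zero => rfl
    | succ n ih =>
      rw [ih, pow_succ', Equiv.Perm.mul_apply]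
      exact Quot.sound (hrot _)
  have hs : ∀ e b, (Quot.mk (fun v w : V => ∃ e ∉ (∅ : Finset E),
      v = F.vert (e, false) ∧ w = F.vert (e, true)) (F.vert (e, b))) =
      Quot.mk _ (F.vert (e, false)) := by
    rintro e (_ | _)
    · rfl
    · exact (Quot.sound ⟨e, by simp, rfl, rfl⟩).symm
  rw [← Nat.card_sum, numComp]
  classical
  let inv : V → Quot r ⊕ F.Isolated := fun v =>
    if h : ∃ d, F.vert d = v then Sum.inl (Quot.mk r h.choose.1)
    else Sum.inr ⟨v, fun d hd => h ⟨d, hd⟩⟩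
  have hinv : ∀ d, inv (F.vert d) = Sum.inl (Quot.mk r d.1) := by
    intro d
    have h : ∃ d', F.vert d' = F.vert d := ⟨d, rfl⟩
    simp only [inv, dif_pos h]
    exact congrArg Sum.inl (hcyc _ _ ((F.sameCycle_iff _ _).2 h.choose_spec))
  have hinv' : ∀ v : F.Isolated, inv v.1 = Sum.inr v := by
    rintro ⟨v, hv⟩
    have h : ¬ ∃ d, F.vert d = v := fun ⟨d, hd⟩ => hv d hd
    simp only [inv, dif_neg h]
  refine Nat.card_congr
    { toFun := Sum.elim (Quot.lift (fun e => Quot.mk _ (F.vert (e, false))) ?_)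
        (fun v => Quot.mk _ v.1)
      invFun := Quot.lift inv ?_
      left_inv := ?_
      right_inv := ?_ }
  · intro x y h
    obtain ⟨b, b', h⟩ := hr x y h
    rw [← hs x b, ← hs y b', h]
  · rintro v w ⟨e, -, rfl, rfl⟩
    rw [hinv, hinv]
  · rintro (e | v)
    · induction e using Quot.ind with | _ e
      exact hinv (e, false)
    · exact hinv' v
  · rintro ⟨v⟩
    by_cases h : ∃ d, F.vert d = v
    · obtain ⟨⟨e, b⟩, rfl⟩ := h
      change Sum.elim _ _ (inv _) = _
      rw [hinv]
      exact (hs e b).symm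
    · change Sum.elim _ _ (inv _) = _
      rw [hinv' ⟨v, fun d hd => h ⟨d, hd⟩⟩]
      rfl

/-- The diagram of the (alternating) link associated with a fatgraph of genus zero: there is a
crossing on every bridge, placed so that its 0-smoothing follows the sides of the bridge and its
1-smoothing cuts the bridge, and the crossings are connected along the boundaries of the islands. A
vertex without half-edges gives a component without crossings. -/
def assocLink [LinearOrder E] [Finite V] [Finite E] (F : Fatgraph V E) (hF : F.IsGenusZero) :
    LinkDiagram E F.Isolated where
  join := (strandEnds E).permCongr F.arcSwap
  join_join t := by
    obtain ⟨t, rfl⟩ := (strandEnds E).surjective t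
    rcases t with d | d <;> simp [Equiv.permCongr_apply, arcSwap]
  join_ne t := by
    obtain ⟨t, rfl⟩ := (strandEnds E).surjective t
    rcases t with d | d <;> simp [Equiv.permCongr_apply, arcSwap]
  planar := by
    have h1 := F.card_faces
    have h2 := F.card_components
    have h3 : Nat.card (F.Bdry ∅) = Nat.card (F.Curve ∅) + Nat.card F.Isolated := Nat.card_sum
    have h4 : F.twoGenus ∅ = 0 := hF
    simp only [twoGenus, nullity, rank, numBdry, Finset.card_empty] at h4
    omega

end Fatgraph

end

open scoped TensorProduct DirectSum

noncomputable section

/-! Removing a bridge never raises the genus (`Fatgraph.twoGenus_insert_le`), so over a fatgraph of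
genus zero the genus factor of every state is trivial. The boundary of the surface of a state and
the cycles of the corresponding state of the diagram run through the same arcs
(`Fatgraph.curveEquiv`), and removing a bridge induces the same product or coproduct on both sides
(`Fatgraph.surgeryCoeff_assocLink`). Hence in height `i` the chromatic complex is `V^{⊗v} ⊗ C̃ⁱ(L) ⊗
R^{⊗i}`, with differential `1 ⊗ d ⊗ Δ̄` (`Fatgraph.rTwist`).

The map `Δ̄` does not square to zero. On the contrary, it is split injective over `ℤ`: its
coefficients at the words with an inserted letter `x₀` form an identity matrix
(`rDeltaCoeff_insertNth`). So the cycles in height `i` are `V^{⊗v} ⊗ Zⁱ ⊗ R^{⊗i}`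
(`RTwist.mem_cycles_iff`), while the boundaries are `V^{⊗v} ⊗ Bⁱ ⊗ Δ̄R^{⊗(i-1)}`
(`RTwist.HasBoundaries`). Splitting `R^{⊗i}` into `Δ̄R^{⊗(i-1)}` and a free complement, the quotient
is `Zⁱ/Bⁱ` on the first summand and all of `Zⁱ` on the second, which is the claim.

The last step is carried out in coordinates. A cycle is recorded by its slices at the words with
inserted `x₀`, taken modulo boundaries, and by its residues at the other words.
`RTwist.coordinates_surjective` and `RTwist.ker_coordinates` show that these coordinates describe
the homology. Tensoring with the finite free modules from `V` and `R` only produces finite powers.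
-/

/-! ### Merging two classes of a quotient -/

-- Imposing one more relation loses at most one class. This counts both the components of a graph
-- when an edge is added and the cycles of a permutation composed with a transposition.
open Classical in
theorem card_quot_eq_card_quot_or_add {X : Type*} [Finite X] (r : X → X → Prop) (a b : X) :
    Nat.card (Quot r) = Nat.card (Quot fun x y => r x y ∨ (x = a ∧ y = b)) +
      if Quot.mk r a = Quot.mk r b then 0 else 1 := by
  set s : X → X → Prop := fun x y => r x y ∨ (x = a ∧ y = b) with hs
  let proj : Quot r → Quot s := Quot.lift (Quot.mk s) fun x y h => Quot.sound (Or.inl h)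
  have hab : Quot.mk s a = Quot.mk s b := Quot.sound (Or.inr ⟨rfl, rfl⟩)
  split_ifs with h
  · refine Nat.card_congr
      { toFun := proj
        invFun := Quot.lift (Quot.mk r) ?_
        left_inv := by rintro ⟨x⟩; rfl
        right_inv := by rintro ⟨x⟩; rfl }
    rintro x y (hxy | ⟨rfl, rfl⟩)
    · exact Quot.sound hxy
    · exact h
  -- `φ` pushes the class of `b` onto that of `a`, so it factors through `Quot s`. The factorisation
  -- `ψ` inverts the projection away from the class of `b`, which is matched with `none`.
  · let φ : Quot r → Quot r := fun x => if x = Quot.mk r b then Quot.mk r a else x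
    let ψ : Quot s → Quot r := Quot.lift (fun x => φ (Quot.mk r x)) (by
      rintro x y (hxy | ⟨rfl, rfl⟩)
      · exact congrArg φ (Quot.sound hxy)
      · simp [φ])
    rw [← Finite.card_option]
    refine Nat.card_congr
      { toFun := fun x => if x = Quot.mk r b then none else some (proj x)
        invFun := fun q => q.elim (Quot.mk r b) ψ
        left_inv := ?_
        right_inv := ?_ }
    · rintro ⟨x⟩
      by_cases hx : Quot.mk r x = Quot.mk r b
      · simp [hx]
      · simp only [if_neg hx]
        change φ (Quot.mk r x) = _
        simp [φ, hx]
    · rintro (_ | ⟨⟨x⟩⟩)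
      · simp
      · change (if φ (Quot.mk r x) = _ then _ else some (proj (φ (Quot.mk r x)))) = _
        by_cases hx : Quot.mk r x = Quot.mk r b
        · have h2 : φ (Quot.mk r x) = Quot.mk r a := by simp [φ, hx]
          rw [h2, if_neg h]
          exact congrArg some (hab.trans (congrArg proj hx).symm)
        · have h2 : φ (Quot.mk r x) = Quot.mk r x := by simp [φ, hx]
          rw [h2, if_neg hx]

/-! ### The cycles of a permutation composed with a transposition -/

/-- The new orbit of `a` follows the old one, which avoids `b`, until the old one would return to
`a`; there the transposition diverts it to `b`. -/
theorem sameCycle_swap_mul_of_not_sameCycle {α : Type*} [Finite α] [DecidableEq α]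
    (g : Equiv.Perm α) {a b : α} (h : ¬ g.SameCycle a b) : (Equiv.swap a b * g).SameCycle a b := by
  set f := Equiv.swap a b * g with hf
  have key : ∀ k : ℕ, f.SameCycle a ((g ^ k) a) := by
    intro k
    induction k with
    | zero => exact Equiv.Perm.SameCycle.refl _ _
    | succ k ih =>
      by_cases h1 : (g ^ (k + 1)) a = a
      · rw [h1]
      · have h2 : (g ^ (k + 1)) a ≠ b := fun h2 => h ⟨(k + 1 : ℕ), by rw [zpow_natCast]; exact h2⟩
        have h3 : f ((g ^ k) a) = (g ^ (k + 1)) a := by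
          rw [hf, Equiv.Perm.mul_apply, ← Equiv.Perm.mul_apply g, ← pow_succ',
            Equiv.swap_apply_of_ne_of_ne h1 h2]
        rw [← h3]
        exact Equiv.Perm.sameCycle_apply_right.2 ih
  -- `(g ^ n) a` is the point from which `g` returns to `a`.
  obtain ⟨n, hn⟩ : ∃ n, orderOf g = n + 1 := Nat.exists_eq_succ_of_ne_zero (orderOf_pos g).ne'
  have h3 : f ((g ^ n) a) = b := by
    rw [hf, Equiv.Perm.mul_apply, ← Equiv.Perm.mul_apply g, ← pow_succ', ← hn, pow_orderOf_eq_one,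
      Equiv.Perm.one_apply, Equiv.swap_apply_left]
  rw [← h3]
  exact Equiv.Perm.sameCycle_apply_right.2 (key n)

theorem Equiv.Perm.SameCycle.quot_mk_eq {α β : Type*} [Finite α] {g : Equiv.Perm α}
    {φ : α → β} (hφ : ∀ x, φ (g x) = φ x) {x y : α} (h : g.SameCycle x y) : φ x = φ y := by
  obtain ⟨n, rfl⟩ := h.exists_nat_pow_eq
  clear h
  induction n with
  | zero => rfl
  | succ n ih => rw [ih, pow_succ', Equiv.Perm.mul_apply, hφ]

/-- Once `a` and `b` are identified, the transposition acts trivially on classes. The common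
quotient allows the cycle counts of the two permutations to be compared. -/
theorem card_cycles_or_swap_mul {α : Type*} [Finite α] [DecidableEq α] (g : Equiv.Perm α) (a b : α) :
    Nat.card (Quot fun x y => (Equiv.swap a b * g).SameCycle x y ∨ (x = a ∧ y = b)) =
      Nat.card (Quot fun x y => g.SameCycle x y ∨ (x = a ∧ y = b)) := by
  have swap_eq : ∀ (r : α → α → Prop), Quot.mk r a = Quot.mk r b →
      ∀ x, Quot.mk r (Equiv.swap a b x) = Quot.mk r x := by
    intro r h x
    rw [Equiv.swap_apply_def]
    split_ifs with h1 h2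
    · rw [h1, h]
    · rw [h2, h]
    · rfl
  refine Nat.card_congr
    { toFun := Quot.lift (Quot.mk _) ?_
      invFun := Quot.lift (Quot.mk _) ?_
      left_inv := by rintro ⟨x⟩; rfl
      right_inv := by rintro ⟨x⟩; rfl }
  · rintro x y (h | ⟨rfl, rfl⟩)
    · refine h.quot_mk_eq fun x => ?_
      rw [Equiv.Perm.mul_apply, swap_eq _ (Quot.sound (Or.inr ⟨rfl, rfl⟩))]
      exact Quot.sound (Or.inl (Equiv.Perm.sameCycle_apply_left.2 (Equiv.Perm.SameCycle.refl _ _)))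
    · exact Quot.sound (Or.inr ⟨rfl, rfl⟩)
  · rintro x y (h | ⟨rfl, rfl⟩)
    · refine h.quot_mk_eq fun x => ?_
      rw [← swap_eq _ (Quot.sound (Or.inr ⟨rfl, rfl⟩)), ← Equiv.Perm.mul_apply]
      exact Quot.sound (Or.inl (Equiv.Perm.sameCycle_apply_left.2 (Equiv.Perm.SameCycle.refl _ _)))
    · exact Quot.sound (Or.inr ⟨rfl, rfl⟩)

theorem card_cycles_swap_mul_le {α : Type*} [Finite α] [DecidableEq α] (g : Equiv.Perm α)
    (a b : α) : Nat.card (Quotient (Equiv.Perm.SameCycle.setoid (Equiv.swap a b * g))) ≤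
      Nat.card (Quotient (Equiv.Perm.SameCycle.setoid g)) + 1 := by
  have h1 := card_quot_eq_card_quot_or_add (fun x y => (Equiv.swap a b * g).SameCycle x y) a b
  have h2 := card_quot_eq_card_quot_or_add (fun x y => g.SameCycle x y) a b
  rw [card_cycles_or_swap_mul] at h1
  change Nat.card (Quot fun x y => (Equiv.swap a b * g).SameCycle x y) ≤
    Nat.card (Quot fun x y => g.SameCycle x y) + 1
  split_ifs at h1 <;> omega

theorem card_cycles_swap_mul_lt {α : Type*} [Finite α] [DecidableEq α] (g : Equiv.Perm α)
    {a b : α} (h : ¬ g.SameCycle a b) :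
    Nat.card (Quotient (Equiv.Perm.SameCycle.setoid (Equiv.swap a b * g))) <
      Nat.card (Quotient (Equiv.Perm.SameCycle.setoid g)) := by
  have h1 := card_quot_eq_card_quot_or_add (fun x y => (Equiv.swap a b * g).SameCycle x y) a b
  have h2 := card_quot_eq_card_quot_or_add (fun x y => g.SameCycle x y) a b
  rw [card_cycles_or_swap_mul, if_pos (Quot.sound (sameCycle_swap_mul_of_not_sameCycle g h))] at h1
  have h3 : Quot.mk (fun x y => g.SameCycle x y) a ≠ Quot.mk _ b :=
    fun h3 => h (Quotient.exact (s := Equiv.Perm.SameCycle.setoid g) h3)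
  rw [if_neg h3] at h2
  change Nat.card (Quot fun x y => (Equiv.swap a b * g).SameCycle x y) <
    Nat.card (Quot fun x y => g.SameCycle x y)
  omega

/-! ### Removing a bridge from a state -/

namespace Fatgraph

variable {V E : Type*}

theorem vert_rot (F : Fatgraph V E) (d : E × Bool) : F.vert (F.rot d) = F.vert d :=
  (F.sameCycle_iff _ _).1 (Equiv.Perm.sameCycle_apply_left.2 (Equiv.Perm.SameCycle.refl _ _))

variable [LinearOrder E]

theorem bridgePerm_of_mem {A : Finset E} {e : E} (he : e ∈ A) (b : Bool) :
    bridgePerm A (e, b) = (e, b) := if_pos he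

theorem bridgePerm_of_notMem {A : Finset E} {e : E} (he : e ∉ A) (b : Bool) :
    bridgePerm A (e, b) = (e, !b) := if_neg he

/-- Putting a bridge back only interchanges its two half-edges in `bridgePerm`, so the change in
boundary components is that of cycles under a transposition. -/
theorem bdryPerm_eq_swap_mul (F : Fatgraph V E) {A : Finset E} {e : E} (he : e ∉ A) :
    F.bdryPerm A = Equiv.swap (e, false) (e, true) * F.bdryPerm (insert e A) := by
  ext1 d
  rw [Equiv.Perm.mul_apply]
  simp only [bdryPerm, Equiv.trans_apply]
  generalize F.rot d = x
  obtain ⟨x, b⟩ := x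
  by_cases hx : x = e
  · subst hx
    rw [bridgePerm_of_notMem he, bridgePerm_of_mem (Finset.mem_insert_self _ _)]
    cases b <;> simp
  · have h1 : ∀ c b', ((x, c) : E × Bool) ≠ (e, b') := fun c b' h => hx (congrArg Prod.fst h)
    by_cases hA : x ∈ A
    · rw [bridgePerm_of_mem hA, bridgePerm_of_mem (Finset.mem_insert_of_mem hA),
        Equiv.swap_apply_of_ne_of_ne (h1 _ _) (h1 _ _)]
    · rw [bridgePerm_of_notMem hA, bridgePerm_of_notMem (by simp [hx, hA]),
        Equiv.swap_apply_of_ne_of_ne (h1 _ _) (h1 _ _)]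

theorem curve_eq_iff (F : Fatgraph V E) (A : Finset E) (d d' : E × Bool) :
    F.curve A d = F.curve A d' ↔ (F.bdryPerm A).SameCycle d d' :=
  ⟨fun h => Quotient.exact h, fun h => Quotient.sound h⟩

theorem curve_insert_eq_of_ne [Finite E] (F : Fatgraph V E) {A : Finset E} {e : E} (he : e ∉ A)
    (h : F.curve A (e, false) ≠ F.curve A (e, true)) :
    F.curve (insert e A) (e, false) = F.curve (insert e A) (e, true) := by
  by_contra h2
  rw [curve_eq_iff] at h2
  rw [Ne, curve_eq_iff, bdryPerm_eq_swap_mul F he] at h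
  exact h (sameCycle_swap_mul_of_not_sameCycle _ h2)

/-- A boundary curve stays on its island or crosses a bridge that is kept, so it never leaves its
component. -/
theorem component_eq_of_curve_eq [Finite E] (F : Fatgraph V E) (A : Finset E) {d d' : E × Bool}
    (h : F.curve A d = F.curve A d') :
    Quot.mk (fun v w : V => ∃ e ∉ A, v = F.vert (e, false) ∧ w = F.vert (e, true)) (F.vert d) =
      Quot.mk _ (F.vert d') := by
  refine ((F.curve_eq_iff A d d').1 h).quot_mk_eq (φ := fun d => Quot.mk _ (F.vert d)) fun x => ?_
  rw [← F.vert_rot x]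
  simp only [bdryPerm, Equiv.trans_apply]
  generalize F.rot x = y
  obtain ⟨y, b⟩ := y
  by_cases hy : y ∈ A
  · rw [bridgePerm_of_mem hy]
  · rw [bridgePerm_of_notMem hy]
    cases b
    · exact (Quot.sound ⟨y, hy, rfl, rfl⟩).symm
    · exact Quot.sound ⟨y, hy, rfl, rfl⟩

/-- Here `2g = 2k - p + |E(H)| - |V|`, and `|E(H)|` drops by one. If `k` is unchanged, it suffices
that `p` drops by at most one. If `k` grows by one, the ends of the bridge lie in different
components, hence on different boundary curves after the removal, and `p` has grown. -/
theorem twoGenus_insert_le [Finite V] [Finite E] (F : Fatgraph V E) {A : Finset E} {e : E}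
    (he : e ∉ A) : F.twoGenus (insert e A) ≤ F.twoGenus A := by
  have hk := card_quot_eq_card_quot_or_add (fun v w : V => ∃ e' ∉ insert e A,
    v = F.vert (e', false) ∧ w = F.vert (e', true)) (F.vert (e, false)) (F.vert (e, true))
  have hrel : (fun v w : V => (∃ e' ∉ insert e A, v = F.vert (e', false) ∧ w = F.vert (e', true)) ∨
      (v = F.vert (e, false) ∧ w = F.vert (e, true))) =
      fun v w : V => ∃ e' ∉ A, v = F.vert (e', false) ∧ w = F.vert (e', true) := by
    funext v w
    refine propext ⟨?_, ?_⟩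
    · rintro (⟨e', h1, h2⟩ | h2)
      · exact ⟨e', fun h => h1 (Finset.mem_insert_of_mem h), h2⟩
      · exact ⟨e, he, h2⟩
    · rintro ⟨e', h1, h2⟩
      by_cases h3 : e' = e
      · exact Or.inr (h3 ▸ h2)
      · exact Or.inl ⟨e', by simp [h1, h3], h2⟩
  rw [hrel] at hk
  change F.numComp (insert e A) = F.numComp A + _ at hk
  have hp1 := card_cycles_swap_mul_le (F.bdryPerm (insert e A)) (e, false) (e, true)
  have hp2 := fun h => card_cycles_swap_mul_lt (F.bdryPerm (insert e A)) (a := (e, false))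
    (b := (e, true)) h
  rw [← bdryPerm_eq_swap_mul F he] at hp1 hp2
  have hb : ∀ B, F.numBdry B =
      Nat.card (Quotient (Equiv.Perm.SameCycle.setoid (F.bdryPerm B))) + Nat.card F.Isolated :=
    fun B => Nat.card_sum
  have hb1 := hb A
  have hb2 := hb (insert e A)
  have hc := Finset.card_insert_of_notMem he
  simp only [twoGenus, nullity, rank]
  split_ifs at hk with h
  · omega
  · have := hp2 fun h' => h (F.component_eq_of_curve_eq _ ((F.curve_eq_iff _ _ _).2 h'))
    omega

/-- The upper bound suffices: the genus factor is indexed by `Fin (F.twoGenus A).toNat`, which is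
then empty. -/
theorem IsGenusZero.twoGenus_nonpos [Finite V] [Finite E] {F : Fatgraph V E} (hF : F.IsGenusZero)
    (A : Finset E) : F.twoGenus A ≤ 0 := by
  induction A using Finset.induction_on with
  | empty => exact hF.le
  | insert e A he ih => exact (F.twoGenus_insert_le he).trans ih

end Fatgraph

/-! ### Surgeries under a relabelling of the curves -/

theorem comulCoeff_swap (a b c : Bool) : comulCoeff a b c = comulCoeff a c b := by
  cases a <;> cases b <;> cases c <;> rfl

/-- The coefficients of a surgery do not depend on how the curves are labelled and cut into arcs,
nor on the order of the two arcs on the curves obtained. -/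
theorem surgeryCoeff_congr {T T₂ C C₂ C' C₂' O : Type*} {c : T → C} {c' : T → C'} {c₂ : T₂ → C₂}
    {c₂' : T₂ → C₂'} {π : T₂ → T} (hπ : Function.Surjective π) (σ : C ≃ C₂) (σ' : C' ≃ C₂')
    (hσ : ∀ t, c₂ t = σ (c (π t))) (hσ' : ∀ t, c₂' t = σ' (c' (π t))) {a b : T} {a₂ b₂ : T₂}
    (ha : c (π a₂) = c a) (hb : c (π b₂) = c b) (ha' : c' (π a₂) = c' b) (hb' : c' (π b₂) = c' a)
    (hab : c a ≠ c b → c' a = c' b) (s : C₂ ⊕ O → Bool) (s' : C₂' ⊕ O → Bool) :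
    surgeryCoeff c c' a b (s ∘ σ.sumCongr (Equiv.refl O)) (s' ∘ σ'.sumCongr (Equiv.refl O)) =
      surgeryCoeff c₂ c₂' a₂ b₂ s s' := by
  have ha₂ : c₂ a₂ = σ (c a) := by rw [hσ, ha]
  have hb₂ : c₂ b₂ = σ (c b) := by rw [hσ, hb]
  have h1 : (∀ t, c t ≠ c a → c t ≠ c b → s' (Sum.inl (σ' (c' t))) = s (Sum.inl (σ (c t)))) ↔
      ∀ t, c₂ t ≠ c₂ a₂ → c₂ t ≠ c₂ b₂ → s' (Sum.inl (c₂' t)) = s (Sum.inl (c₂ t)) := by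
    simp only [ha₂, hb₂, hσ, hσ', ne_eq, σ.apply_eq_iff_eq]
    exact ⟨fun h t => h (π t), fun h t => by obtain ⟨t, rfl⟩ := hπ t; exact h t⟩
  classical
  unfold surgeryCoeff
  refine ite_congr (propext (and_congr Iff.rfl h1)) (fun _ => ?_) fun _ => rfl
  refine ite_congr (by rw [ha₂, hb₂, σ.apply_eq_iff_eq]) (fun _ => ?_) fun h => ?_
  -- After a split the two new curves appear in the opposite order, which cocommutativity absorbs;
  -- after a merge `hab` says that they coincide.
  · rw [comulCoeff_swap]
    simp [hσ', ha₂, ha', hb']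
  · rw [ha₂, hb₂, σ.apply_eq_iff_eq] at h
    simp [hσ', ha₂, hb₂, ha', hab h]

/-! ### The curves of a state of the associated diagram -/

namespace Fatgraph

variable {V E : Type*}

/-- The boundary arc of an island along which a strand of the associated diagram leaves its
crossing. -/
def strandArc (F : Fatgraph V E) (t : E × Fin 4) : E × Bool :=
  Sum.elim id F.rot.symm ((strandEnds E).symm t)

theorem strandArc_inl (F : Fatgraph V E) (d : E × Bool) :
    F.strandArc (strandEnds E (Sum.inl d)) = d := by
  simp [strandArc]

theorem strandArc_inr (F : Fatgraph V E) (d : E × Bool) :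
    F.strandArc (strandEnds E (Sum.inr d)) = F.rot.symm d := by
  simp [strandArc]

theorem strandArc_surjective (F : Fatgraph V E) : Function.Surjective F.strandArc :=
  fun d => ⟨_, F.strandArc_inl d⟩

variable [LinearOrder E]

/-- Either smoothing pairs the ends where an arc arrives (`Sum.inr`) with those where one departs
(`Sum.inl`), across the bridge if it is kept and at the same half-edge if it is cut. Traversing an
arc and then a smoothing is therefore `bdryPerm`. -/
theorem smooth_strandEnds_inr (A : Finset E) (d : E × Bool) :
    LinkDiagram.smooth A (strandEnds E (Sum.inr d)) = strandEnds E (Sum.inl (bridgePerm A d)) := by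
  obtain ⟨e, b⟩ := d
  by_cases h : e ∈ A
  · rw [bridgePerm_of_mem h]
    cases b <;> simp [LinkDiagram.smooth, strandEnds, h]
  · rw [bridgePerm_of_notMem h]
    cases b <;> simp [LinkDiagram.smooth, strandEnds, h]

theorem smooth_strandEnds_inl (A : Finset E) (d : E × Bool) :
    LinkDiagram.smooth A (strandEnds E (Sum.inl d)) = strandEnds E (Sum.inr (bridgePerm A d)) := by
  obtain ⟨e, b⟩ := d
  by_cases h : e ∈ A
  · rw [bridgePerm_of_mem h]
    cases b <;> simp [LinkDiagram.smooth, strandEnds, h]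
  · rw [bridgePerm_of_notMem h]
    cases b <;> simp [LinkDiagram.smooth, strandEnds, h]

theorem bridgePerm_bridgePerm (A : Finset E) (d : E × Bool) :
    bridgePerm A (bridgePerm A d) = d := by
  obtain ⟨e, b⟩ := d
  by_cases h : e ∈ A
  · rw [bridgePerm_of_mem h, bridgePerm_of_mem h]
  · rw [bridgePerm_of_notMem h, bridgePerm_of_notMem h, Bool.not_not]

theorem curve_bdryPerm (F : Fatgraph V E) (A : Finset E) (d : E × Bool) :
    F.curve A (F.bdryPerm A d) = F.curve A d :=
  (F.curve_eq_iff _ _ _).2 (Equiv.Perm.sameCycle_apply_left.2 (Equiv.Perm.SameCycle.refl _ _))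

/-- The arc ending at the half-edge `d` is continued by the arc starting at `bridgePerm A d`. -/
theorem curve_rot_symm (F : Fatgraph V E) (A : Finset E) (d : E × Bool) :
    F.curve A (F.rot.symm d) = F.curve A (bridgePerm A d) := by
  rw [← F.curve_bdryPerm A (F.rot.symm d)]
  simp [bdryPerm]

variable [Finite V] [Finite E]

theorem assocLink_join_inl (F : Fatgraph V E) (hF : F.IsGenusZero) (d : E × Bool) :
    (F.assocLink hF).join (strandEnds E (Sum.inl d)) = strandEnds E (Sum.inr (F.rot d)) := by
  simp [assocLink, Equiv.permCongr_apply, arcSwap]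

theorem assocLink_join_inr (F : Fatgraph V E) (hF : F.IsGenusZero) (d : E × Bool) :
    (F.assocLink hF).join (strandEnds E (Sum.inr d)) = strandEnds E (Sum.inl (F.rot.symm d)) := by
  simp [assocLink, Equiv.permCongr_apply, arcSwap]

theorem assocLink_curve_join (F : Fatgraph V E) (hF : F.IsGenusZero) (A : Finset E)
    (t : E × Fin 4) :
    (F.assocLink hF).curve A ((F.assocLink hF).join t) = (F.assocLink hF).curve A t := by
  symm
  exact Quot.sound (Or.inl rfl)

theorem assocLink_curve_smooth (F : Fatgraph V E) (hF : F.IsGenusZero) (A : Finset E)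
    (t : E × Fin 4) :
    (F.assocLink hF).curve A (LinkDiagram.smooth A t) = (F.assocLink hF).curve A t := by
  symm
  exact Quot.sound (Or.inr rfl)

/-- The boundary components of a state of the fatgraph are the cycles of the corresponding state of
the associated diagram. -/
def curveEquiv (F : Fatgraph V E) (hF : F.IsGenusZero) (A : Finset E) :
    F.Curve A ≃ (F.assocLink hF).Curve A where
  toFun := Quotient.lift (fun d => (F.assocLink hF).curve A (strandEnds E (Sum.inl d))) (by
    intro d d' h
    refine Equiv.Perm.SameCycle.quot_mk_eq (g := F.bdryPerm A)
      (φ := fun d => (F.assocLink hF).curve A (strandEnds E (Sum.inl d))) (fun x => ?_) h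
    rw [← F.assocLink_curve_join hF A (strandEnds E (Sum.inl x)), assocLink_join_inl,
      ← F.assocLink_curve_smooth hF A (strandEnds E (Sum.inr _)), smooth_strandEnds_inr]
    rfl)
  invFun := Quot.lift (fun t => F.curve A (F.strandArc t)) (by
    intro t t' h
    obtain ⟨t, rfl⟩ := (strandEnds E).surjective t
    rcases h with rfl | rfl <;> rcases t with d | d
    · rw [assocLink_join_inl, strandArc_inl, strandArc_inr, Equiv.symm_apply_apply]
    · rw [assocLink_join_inr, strandArc_inl, strandArc_inr]
    · rw [smooth_strandEnds_inl, strandArc_inl, strandArc_inr, curve_rot_symm,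
        bridgePerm_bridgePerm]
    · rw [smooth_strandEnds_inr, strandArc_inl, strandArc_inr, curve_rot_symm])
  left_inv := by
    rintro ⟨d⟩
    exact congrArg (F.curve A) (F.strandArc_inl d)
  right_inv := by
    rintro ⟨t⟩
    obtain ⟨t, rfl⟩ := (strandEnds E).surjective t
    change (F.assocLink hF).curve A (strandEnds E (Sum.inl (F.strandArc _))) =
      (F.assocLink hF).curve A _
    rcases t with d | d
    · rw [strandArc_inl]
    · rw [strandArc_inr, ← assocLink_join_inr F hF, assocLink_curve_join]

theorem assocLink_curve_eq (F : Fatgraph V E) (hF : F.IsGenusZero) (A : Finset E)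
    (t : E × Fin 4) :
    (F.assocLink hF).curve A t = F.curveEquiv hF A (F.curve A (F.strandArc t)) :=
  ((F.curveEquiv hF A).apply_symm_apply (Quot.mk _ t)).symm

/-- The boundary components of a state and the cycles of the corresponding state of the associated
diagram, including those without crossings. -/
def bdryEquiv (F : Fatgraph V E) (hF : F.IsGenusZero) (A : Finset E) :
    F.Bdry A ≃ (F.assocLink hF).Cycle A :=
  (F.curveEquiv hF A).sumCongr (Equiv.refl _)

/-- The strand ends `0` and `2` lie on the arcs arriving at `(e, true)` and `(e, false)`. These
continue across the bridge while it is present and turn back when it is cut, so the two marked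
curves are in the same order before the surgery and in the opposite order after it. -/
theorem surgeryCoeff_assocLink (F : Fatgraph V E) (hF : F.IsGenusZero) {A : Finset E} {e : E}
    (he : e ∉ A) (s : (F.assocLink hF).Cycle A → Bool)
    (s' : (F.assocLink hF).Cycle (insert e A) → Bool) :
    surgeryCoeff (F.curve A) (F.curve (insert e A)) (e, false) (e, true)
        (s ∘ F.bdryEquiv hF A) (s' ∘ F.bdryEquiv hF (insert e A)) =
      surgeryCoeff ((F.assocLink hF).curve A) ((F.assocLink hF).curve (insert e A)) (e, 0) (e, 2)
        s s' := by
  have h0 : F.strandArc (e, 0) = F.rot.symm (e, true) := F.strandArc_inr (e, true)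
  have h2 : F.strandArc (e, 2) = F.rot.symm (e, false) := F.strandArc_inr (e, false)
  have hm := Finset.mem_insert_self e A
  refine surgeryCoeff_congr F.strandArc_surjective _ _ (F.assocLink_curve_eq hF A)
    (F.assocLink_curve_eq hF _) ?_ ?_ ?_ ?_ (F.curve_insert_eq_of_ne he) s s'
  · rw [h0, curve_rot_symm, bridgePerm_of_notMem he]; rfl
  · rw [h2, curve_rot_symm, bridgePerm_of_notMem he]; rfl
  · rw [h0, curve_rot_symm, bridgePerm_of_mem hm]
  · rw [h2, curve_rot_symm, bridgePerm_of_mem hm]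

end Fatgraph

theorem vPowDeg_comp_equiv {ι κ : Type*} (e : ι ≃ κ) (s : κ → Bool) :
    vPowDeg (s ∘ e) = vPowDeg s :=
  finsum_comp_equiv (f := fun i => vDeg (s i)) e

theorem vPowDeg_of_isEmpty {ι : Type*} [IsEmpty ι] (s : ι → Bool) : vPowDeg s = 0 :=
  finsum_of_isEmpty _

/-! ### Tensoring a based complex with tensor powers of `R` -/

/-- `RTwist K C ι` presents the based complex `C` as `⨁ᵢ V^{⊗ι} ⊗ Kⁱ ⊗ R^{⊗i}` with the differential
`1 ⊗ d ⊗ Δ̄`. -/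
structure RTwist (K C : BasedComplex) (ι : Type*) where
  size : K.Gen → ℕ
  height_eq : ∀ x, K.height x = size x
  gen : (ι → Bool) → (x : K.Gen) → (Fin (size x) → Bool) → C.Gen
  gen_injective : ∀ {l x u l' x' u'}, gen l x u = gen l' x' u' →
    l = l' ∧ (⟨x, u⟩ : Σ x, Fin (size x) → Bool) = ⟨x', u'⟩
  gen_surjective : ∀ y, ∃ l x u, gen l x u = y
  height_gen : ∀ l x u, C.height (gen l x u) = size x
  deg_gen : ∀ l x u, C.deg (gen l x u) = vPowDeg l + K.deg x + rPowDeg u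
  size_eq_of_coeff_ne_zero : ∀ x x', K.coeff x x' ≠ 0 → size x' = size x + 1
  coeff_gen_self : ∀ l x u x' u', C.coeff (gen l x u) (gen l x' u') =
    K.coeff x x' * Fatgraph.rCoeff u u'
  coeff_gen_of_ne : ∀ l x u l' x' u', l ≠ l' → C.coeff (gen l x u) (gen l' x' u') = 0

namespace Fatgraph

theorem genusCoeff_of_eq_zero {m m' : ℕ} (hm : m = 0) (hm' : m' = 0) (t : Fin m → Bool)
    (t' : Fin m' → Bool) : genusCoeff t t' = 1 := by
  subst hm hm'
  have h : t' = t ∘ Fin.cast rfl := Subsingleton.elim _ _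
  simp [genusCoeff, h]

/-- The chromatic complex of a fatgraph of genus zero in terms of the Khovanov complex of the
associated diagram. -/
def rTwist {V E : Type*} [Finite V] [Fintype E] [LinearOrder E] (F : Fatgraph V E)
    (hF : F.IsGenusZero) :
    RTwist (F.assocLink hF).khovanovComplexTilde F.chromaticComplexTilde V where
  size x := x.1.card
  height_eq _ := rfl
  -- The genus factor has an empty index type, so the constant function is its only basis element.
  gen l x u := ⟨x.1, l, x.2 ∘ F.bdryEquiv hF x.1, fun _ => true, u⟩
  gen_injective := by
    rintro l ⟨A, s⟩ u l' ⟨A', s'⟩ u' h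
    obtain rfl : A = A' := congrArg Sigma.fst h
    have h2 := eq_of_heq (Sigma.mk.inj h).2
    simp only [Prod.mk.injEq] at h2
    obtain ⟨h3, h4, -, h5⟩ := h2
    have h6 : s = s' := by
      funext c
      obtain ⟨c, rfl⟩ := (F.bdryEquiv hF A).surjective c
      exact congrFun h4 c
    subst h6
    exact ⟨h3, by rw [h5]⟩
  gen_surjective := by
    rintro ⟨A, l, s, t, u⟩
    refine ⟨l, ⟨A, s ∘ (F.bdryEquiv hF A).symm⟩, u, ?_⟩
    have ht : t = fun _ => true := by
      funext i
      have := i.2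
      have := hF.twoGenus_nonpos A
      omega
    have hs : (s ∘ (F.bdryEquiv hF A).symm) ∘ F.bdryEquiv hF A = s := by
      funext c
      simp
    rw [ht]
    simp only [hs]
    rfl
  height_gen _ _ _ := rfl
  deg_gen := by
    rintro l ⟨A, s⟩ u
    have : IsEmpty (Fin (F.twoGenus A).toNat) := by
      rw [Int.toNat_of_nonpos (hF.twoGenus_nonpos A)]
      infer_instance
    change vPowDeg l + vPowDeg (s ∘ F.bdryEquiv hF A) +
      vPowDeg (fun _ : Fin (F.twoGenus A).toNat => true) + rPowDeg u + A.card =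
      vPowDeg l + (vPowDeg s + A.card) + rPowDeg u
    rw [vPowDeg_comp_equiv, vPowDeg_of_isEmpty (ι := Fin (F.twoGenus A).toNat)]
    ring
  size_eq_of_coeff_ne_zero := by
    rintro ⟨A, s⟩ ⟨A', s'⟩ h
    obtain ⟨e, -, he⟩ := Finset.exists_ne_zero_of_sum_ne_zero h
    have h2 : e ∉ A ∧ A' = insert e A := by
      by_contra h2
      exact he (if_neg h2)
    obtain ⟨h3, rfl⟩ := h2
    exact Finset.card_insert_of_notMem h3
  coeff_gen_self := by
    rintro l ⟨A, s⟩ u ⟨A', s'⟩ u'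
    simp only [chromaticComplexTilde, LinkDiagram.khovanovComplexTilde, Finset.sum_mul]
    refine Finset.sum_congr rfl fun e _ => ?_
    split_ifs with h
    · obtain ⟨he, rfl⟩ := h
      rw [surgeryCoeff_assocLink F hF he, genusCoeff_of_eq_zero
        (Int.toNat_of_nonpos (hF.twoGenus_nonpos _)) (Int.toNat_of_nonpos (hF.twoGenus_nonpos _))]
      ring
    · simp
  coeff_gen_of_ne := by
    rintro l ⟨A, s⟩ u l' ⟨A', s'⟩ u' h
    refine Finset.sum_eq_zero fun e _ => ?_
    simp [Ne.symm h]

end Fatgraph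

/-! ### Splitting off the image of `Δ̄` -/

/-- A splitting of the basis of `R^{⊗i}`, compatible with the map `Δ̄ : R^{⊗(i-1)} → R^{⊗i}`: the
basis elements of the source are indexed by `Src`, with images `delta v`, and the coefficients of
`delta v` at the words in `Src` form the identity matrix. -/
structure WordSplitting (i : ℕ) where
  Src : Type
  Compl : Type
  [fintypeSrc : Fintype Src]
  [decidableEqSrc : DecidableEq Src]
  [fintypeCompl : Fintype Compl]
  word : Src ⊕ Compl ≃ (Fin i → Bool)
  delta : Src → (Fin i → Bool) → ℤ
  delta_word_inl : ∀ v u, delta v (word (Sum.inl u)) = if v = u then 1 else 0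
  rPowDeg_of_delta_ne_zero : ∀ v w, delta v w ≠ 0 → rPowDeg w = rPowDeg (word (Sum.inl v))
  mem_rDeltaImage_iff : ∀ q f, f ∈ rDeltaImage i q ↔ ∃ g : Src → ℤ,
    (∀ v, g v ≠ 0 → rPowDeg (word (Sum.inl v)) = q) ∧ ∀ w, f w = ∑ v, delta v w • g v

namespace WordSplitting

attribute [instance] WordSplitting.fintypeSrc WordSplitting.decidableEqSrc
  WordSplitting.fintypeCompl

variable {i : ℕ} (W : WordSplitting i)

/-- The component of `f` in the complement of the image of `Δ̄`, at the word `c`. -/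
def residue {M : Type*} [AddCommGroup M] (f : (Fin i → Bool) → M) (c : W.Compl) : M :=
  f (W.word (Sum.inr c)) - ∑ v, W.delta v (W.word (Sum.inr c)) • f (W.word (Sum.inl v))

variable {M : Type*} [AddCommGroup M]

/-- The identity block forces `g` to be the restriction of `f` to the source words; the remaining
equations are the vanishing of the residues. Coefficients in any `M` let this serve both for
`R^{⊗i}` itself and for chains with values in `K.Total`. -/
theorem eq_sum_delta_iff (f : (Fin i → Bool) → M) (g : W.Src → M) :
    (∀ w, f w = ∑ v, W.delta v w • g v) ↔
      (∀ v, f (W.word (Sum.inl v)) = g v) ∧ ∀ c, W.residue f c = 0 := by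
  have key : ∀ u, ∑ v, W.delta v (W.word (Sum.inl u)) • g v = g u := by
    intro u
    simp [W.delta_word_inl, ite_smul]
  constructor
  · intro h
    have h1 : ∀ v, f (W.word (Sum.inl v)) = g v := fun v => (h _).trans (key v)
    refine ⟨h1, fun c => ?_⟩
    simp only [residue, h1]
    rw [h, sub_self]
  · rintro ⟨h1, h2⟩ w
    obtain ⟨w, rfl⟩ := W.word.surjective w
    rcases w with u | c
    · rw [h1, key]
    · have := h2 c
      simp only [residue, h1] at this
      exact sub_eq_zero.1 this

/-- `delta` preserves degree, so only values of `f` in the same `P` are subtracted. The family `P`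
is either `⊤` in one degree and `⊥` elsewhere, or the cycles of complementary degree. -/
theorem residue_mem (P : ℤ → Submodule ℤ M) {f : (Fin i → Bool) → M}
    (hf : ∀ w, f w ∈ P (rPowDeg w)) (c : W.Compl) :
    W.residue f c ∈ P (rPowDeg (W.word (Sum.inr c))) := by
  refine sub_mem (hf _) (sum_mem fun v _ => ?_)
  by_cases h : W.delta v (W.word (Sum.inr c)) = 0
  · rw [h, zero_smul]
    exact zero_mem _
  · rw [W.rPowDeg_of_delta_ne_zero _ _ h]
    exact Submodule.smul_mem _ _ (hf _)

/-- Passing from values to source values and residues is a unitriangular change of coordinates, so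
both can be prescribed freely. -/
theorem exists_of_residue (P : ℤ → Submodule ℤ M) (a : W.Src → M) (b : W.Compl → M)
    (ha : ∀ v, a v ∈ P (rPowDeg (W.word (Sum.inl v))))
    (hb : ∀ c, b c ∈ P (rPowDeg (W.word (Sum.inr c)))) :
    ∃ f : (Fin i → Bool) → M, (∀ w, f w ∈ P (rPowDeg w)) ∧
      (∀ v, f (W.word (Sum.inl v)) = a v) ∧ ∀ c, W.residue f c = b c := by
  refine ⟨fun w => Sum.elim a
    (fun c => b c + ∑ v, W.delta v (W.word (Sum.inr c)) • a v) (W.word.symm w), ?_, ?_, ?_⟩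
  · intro w
    obtain ⟨w, rfl⟩ := W.word.surjective w
    rcases w with u | c
    · simpa using ha u
    · simp only [Equiv.symm_apply_apply, Sum.elim_inr]
      refine add_mem (hb c) (sum_mem fun v _ => ?_)
      by_cases h : W.delta v (W.word (Sum.inr c)) = 0
      · rw [h, zero_smul]
        exact zero_mem _
      · rw [W.rPowDeg_of_delta_ne_zero _ _ h]
        exact Submodule.smul_mem _ _ (ha _)
  · simp
  · simp [residue]

/-- The words in the source of a given degree. -/
abbrev SrcOfDeg (q : ℤ) : Type := {v : W.Src // rPowDeg (W.word (Sum.inl v)) = q}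

/-- The words in the complement of a given degree. -/
abbrev ComplOfDeg (q : ℤ) : Type := {c : W.Compl // rPowDeg (W.word (Sum.inr c)) = q}

theorem nonempty_rDeltaImage_equiv (q : ℤ) :
    Nonempty (rDeltaImage i q ≃ₗ[ℤ] (W.SrcOfDeg q → ℤ)) := by
  classical
  let φ : rDeltaImage i q →ₗ[ℤ] (W.SrcOfDeg q → ℤ) :=
    (LinearMap.pi fun u => Finsupp.lapply (W.word (Sum.inl u.1))) ∘ₗ Submodule.subtype _
  refine ⟨LinearEquiv.ofBijective φ ⟨?_, ?_⟩⟩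
  · rw [injective_iff_map_eq_zero]
    rintro ⟨f, hf⟩ h
    obtain ⟨g, hg, hfg⟩ := (W.mem_rDeltaImage_iff q f).1 hf
    have h1 := ((W.eq_sum_delta_iff f g).1 hfg).1
    have hg0 : ∀ v, g v = 0 := by
      intro v
      by_contra h2
      exact h2 ((h1 v).symm.trans (congrFun h ⟨v, hg v h2⟩))
    ext w
    simp [hfg, hg0]
  · intro a
    let g : W.Src → ℤ := fun v => if h : rPowDeg (W.word (Sum.inl v)) = q then a ⟨v, h⟩ else 0
    let f : (Fin i → Bool) →₀ ℤ := Finsupp.equivFunOnFinite.symm fun w => ∑ v, W.delta v w • g v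
    have hfg : ∀ w, f w = ∑ v, W.delta v w • g v := fun w => rfl
    refine ⟨⟨f, (W.mem_rDeltaImage_iff q f).2 ⟨g, fun v hv => ?_, hfg⟩⟩, ?_⟩
    · by_contra h
      exact hv (dif_neg h)
    · funext u
      exact (((W.eq_sum_delta_iff f g).1 hfg).1 u.1).trans (dif_pos u.2)

theorem mem_rPart_iff {q : ℤ} (f : (Fin i → Bool) →₀ ℤ) :
    f ∈ rPart i q ↔ ∀ w, f w ∈ (if rPowDeg w = q then (⊤ : Submodule ℤ ℤ) else ⊥) := by
  rw [rPart, Finsupp.mem_supported]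
  refine ⟨fun h w => ?_, fun h w hw => ?_⟩
  · split_ifs with hw
    · trivial
    · by_contra h2
      exact hw (h (Finsupp.mem_support_iff.2 h2))
  · by_contra h2
    have h3 := h w
    rw [if_neg (show ¬rPowDeg w = q from h2)] at h3
    exact Finsupp.mem_support_iff.1 hw h3

/-- The residues are coordinates on the quotient: they can be prescribed, and they all vanish
exactly on the image of `Δ̄`. In particular the quotient is free. -/
theorem nonempty_rQuot_equiv (q : ℤ) : Nonempty (RQuot i q ≃ₗ[ℤ] (W.ComplOfDeg q → ℤ)) := by
  let φ : rPart i q →ₗ[ℤ] (W.ComplOfDeg q → ℤ) :=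
    (LinearMap.pi fun c => Finsupp.lapply (W.word (Sum.inr c.1)) -
      ∑ v, W.delta v (W.word (Sum.inr c.1)) • Finsupp.lapply (W.word (Sum.inl v))) ∘ₗ
        Submodule.subtype _
  have hφ : ∀ f c, φ f c = W.residue f.1 c.1 := by
    intro f c
    simp [φ, residue]
  have hsurj : Function.Surjective φ := by
    classical
    intro b
    obtain ⟨f, hf, -, hb⟩ := W.exists_of_residue
      (fun r => if r = q then (⊤ : Submodule ℤ ℤ) else ⊥) 0
      (fun c => if h : rPowDeg (W.word (Sum.inr c)) = q then b ⟨c, h⟩ else 0)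
      (fun v => zero_mem _) (fun c => by
        split_ifs
        · trivial
        · exact zero_mem _)
    refine ⟨⟨Finsupp.equivFunOnFinite.symm f, (mem_rPart_iff _).2 hf⟩, ?_⟩
    funext c
    rw [hφ]
    exact (hb c.1).trans (dif_pos c.2)
  have hker : (rDeltaImage i q).submoduleOf (rPart i q) = LinearMap.ker φ := by
    ext ⟨f, hf⟩
    change f ∈ rDeltaImage i q ↔ _
    rw [W.mem_rDeltaImage_iff, LinearMap.mem_ker]
    have hdeg := (mem_rPart_iff f).1 hf
    constructor
    · rintro ⟨g, -, hfg⟩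
      funext c
      rw [hφ]
      exact ((W.eq_sum_delta_iff f g).1 hfg).2 c
    · intro h
      refine ⟨fun v => f (W.word (Sum.inl v)), fun v hv => ?_,
        (W.eq_sum_delta_iff f _).2 ⟨fun _ => rfl, fun c => ?_⟩⟩
      · by_contra h2
        have h3 := hdeg (W.word (Sum.inl v))
        rw [if_neg h2] at h3
        exact hv h3
      · by_cases hc : rPowDeg (W.word (Sum.inr c)) = q
        · rw [← hφ ⟨f, hf⟩ ⟨c, hc⟩, h]
          rfl
        · have h3 := W.residue_mem (fun r => if r = q then (⊤ : Submodule ℤ ℤ) else ⊥) hdeg c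
          simp only [if_neg hc] at h3
          exact h3
  exact ⟨(Submodule.quotEquivOfEq _ _ hker).trans (φ.quotKerEquivOfSurjective hsurj)⟩

end WordSplitting

/-! ### The splitting of the words -/

theorem rPowDeg_eq_sum {ι : Type*} [Fintype ι] (s : ι → Bool) : rPowDeg s = ∑ i, rDeg (s i) :=
  finsum_eq_sum_of_fintype _

theorem rPowDeg_of_rDeltaCoeff_ne_zero {h : ℕ} {u : Fin h → Bool} {w : Fin (h + 1) → Bool}
    (hc : rDeltaCoeff h u w ≠ 0) : rPowDeg w = rPowDeg u := by
  cases h with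
  | zero =>
    have h0 : w 0 = true := by
      by_contra h0
      exact hc (if_neg h0)
    rw [rPowDeg_eq_sum, rPowDeg_eq_sum]
    simp [h0, rDeg]
  | succ h =>
    by_cases h0 : (∀ k : Fin h, w k.castSucc.castSucc = u k.castSucc) ∧
        rDeg (w (Fin.last h).castSucc) + rDeg (w (Fin.last (h + 1))) = rDeg (u (Fin.last h))
    · rw [rPowDeg_eq_sum, rPowDeg_eq_sum, Fin.sum_univ_castSucc, Fin.sum_univ_castSucc,
        Fin.sum_univ_castSucc (n := h), ← h0.2]
      simp only [h0.1]
      ring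
    · exact absurd (if_neg h0) hc

/-- The position of the letter that `Δ̄_h` inserts. -/
def deltaPos : (h : ℕ) → Fin (h + 1)
  | 0 => 0
  | h + 1 => (Fin.last h).castSucc

theorem rDeg_injective : Function.Injective rDeg := by
  intro a b
  cases a <;> cases b <;> simp [rDeg]

/-- For `h ≥ 1` the coproduct of the last letter `x_i` has exactly one term beginning with `x₀`,
namely `x₀ ⊗ x_i`. For `h = 0` the only image is `x₀` itself. This is the split injectivity of `Δ̄`.
-/
theorem rDeltaCoeff_insertNth {h : ℕ} (v u : Fin h → Bool) :
    rDeltaCoeff h v ((deltaPos h).insertNth true u) = if v = u then 1 else 0 := by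
  cases h with
  | zero =>
    rw [if_pos (Subsingleton.elim _ _)]
    change (if (deltaPos 0).insertNth (α := fun _ => Bool) true u 0 = true then (1 : ℤ) else 0) = 1
    exact if_pos (Fin.insertNth_apply_same (α := fun _ => Bool) (deltaPos 0) true u)
  | succ h =>
    have h1 : ∀ k : Fin h, (deltaPos (h + 1)).insertNth (α := fun _ => Bool) true u
        k.castSucc.castSucc = u k.castSucc := by
      intro k
      have : k.castSucc.castSucc = (deltaPos (h + 1)).succAbove k.castSucc := by
        rw [Fin.succAbove_of_castSucc_lt]
        exact Fin.castSucc_lt_castSucc_iff.2 (Fin.castSucc_lt_last k)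
      rw [this, Fin.insertNth_apply_succAbove]
    have h2 : (deltaPos (h + 1)).insertNth (α := fun _ => Bool) true u (Fin.last (h + 1)) =
        u (Fin.last h) := by
      have : Fin.last (h + 1) = (deltaPos (h + 1)).succAbove (Fin.last h) :=
        ((Fin.succAbove_of_le_castSucc _ _ le_rfl).trans (Fin.succ_last h)).symm
      rw [this, Fin.insertNth_apply_succAbove]
    have h3 : (deltaPos (h + 1)).insertNth (α := fun _ => Bool) true u (Fin.last h).castSucc =
        true := Fin.insertNth_apply_same (α := fun _ => Bool) _ _ _
    refine if_congr ?_ rfl rfl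
    rw [h2, h3]
    simp only [h1]
    constructor
    · rintro ⟨h4, h5⟩
      have h6 : rDeg (u (Fin.last h)) = rDeg (v (Fin.last h)) := by
        simpa [rDeg] using h5
      funext k
      induction k using Fin.lastCases with
      | last => exact (rDeg_injective h6).symm
      | cast k => exact (h4 k).symm
    · rintro rfl
      exact ⟨fun _ => rfl, by simp [rDeg]⟩

theorem rPowDeg_insertNth_true {h : ℕ} (u : Fin h → Bool) :
    rPowDeg ((deltaPos h).insertNth (α := fun _ => Bool) true u) = rPowDeg u := by
  refine rPowDeg_of_rDeltaCoeff_ne_zero ?_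
  rw [rDeltaCoeff_insertNth, if_pos rfl]
  exact one_ne_zero

theorem rDelta_apply {h : ℕ} (g : (Fin h → Bool) →₀ ℤ) (w : Fin (h + 1) → Bool) :
    rDelta h g w = ∑ v, rDeltaCoeff h v w • g v := by
  rw [rDelta, Finsupp.linearCombination_apply, Finsupp.sum_fintype _ _ (by simp),
    Finsupp.finsetSum_apply]
  refine Finset.sum_congr rfl fun v _ => ?_
  simp [mul_comm]

namespace WordSplitting

/-- For `i = 0` there is nothing to split off. -/
def zero : WordSplitting 0 where
  Src := Empty
  Compl := Fin 0 → Bool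
  word := Equiv.emptySum _ _
  delta v := v.elim
  delta_word_inl v := v.elim
  rPowDeg_of_delta_ne_zero v := v.elim
  mem_rDeltaImage_iff := by
    intro q f
    simp [rDeltaImage, Finsupp.ext_iff]

/-- The words of length `h + 1` are obtained from those of length `h` by inserting a letter: the
letter `x₀` for the image of `Δ̄_h`, the letter `x₋₂` for a complement. -/
def succ (h : ℕ) : WordSplitting (h + 1) where
  Src := Fin h → Bool
  Compl := Fin h → Bool
  -- `Equiv.boolProdEquivSum` puts `false` on the left; the interchange gives the source words the
  -- letter `true`, which is `x₀`.
  word := (Equiv.sumComm _ _).trans ((Equiv.boolProdEquivSum _).symm.trans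
    (Fin.insertNthEquiv (fun _ => Bool) (deltaPos h)))
  delta := rDeltaCoeff h
  delta_word_inl := rDeltaCoeff_insertNth
  rPowDeg_of_delta_ne_zero v w hvw :=
    (rPowDeg_of_rDeltaCoeff_ne_zero hvw).trans (rPowDeg_insertNth_true v).symm
  mem_rDeltaImage_iff := by
    intro q f
    constructor
    · rintro ⟨g, hg, rfl⟩
      refine ⟨g, fun v hv => ?_, rDelta_apply g⟩
      exact (rPowDeg_insertNth_true v).trans
        ((Finsupp.mem_supported _ _).1 hg (Finsupp.mem_support_iff.2 hv))
    · rintro ⟨g, hg, hf⟩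
      refine ⟨Finsupp.equivFunOnFinite.symm g, (Finsupp.mem_supported _ _).2 fun v hv => ?_, ?_⟩
      · exact (rPowDeg_insertNth_true v).symm.trans (hg v (Finsupp.mem_support_iff.1 hv))
      · ext w
        rw [rDelta_apply, hf]
        rfl

end WordSplitting

/-! ### Matrix entries of the differential -/

namespace BasedComplex

theorem d_apply (C : BasedComplex) [Fintype C.Gen] (z : C.Total) (y : C.Gen) :
    C.d z y = ∑ x, z x * C.coeff x y := by
  rw [d, Finsupp.linearCombination_apply, Finsupp.sum_fintype _ _ (by simp),
    Finsupp.finsetSum_apply]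
  rfl

theorem mem_part_iff (C : BasedComplex) {i j : ℤ} {z : C.Total} :
    z ∈ C.part i j ↔ ∀ x, z x ≠ 0 → C.height x = i ∧ C.deg x = j := by
  rw [part, Finsupp.mem_supported]
  exact ⟨fun h x hx => h (Finsupp.mem_support_iff.2 hx),
    fun h x hx => h x (Finsupp.mem_support_iff.1 hx)⟩

end BasedComplex

/-! ### The chain groups of a twisted complex -/

namespace RTwist

variable {K C : BasedComplex} {ι : Type*} (T : RTwist K C ι)

/-- The component of a chain of height `i` at the basis element `l ⊗ w` of `V^{⊗ι} ⊗ R^{⊗i}`. -/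
def slice (i : ℕ) (l : ι → Bool) (w : Fin i → Bool) : C.Total →ₗ[ℤ] K.Total :=
  (Finsupp.linearEquivFunOnFinite ℤ ℤ K.Gen).symm.toLinearMap ∘ₗ LinearMap.pi fun x =>
    if h : T.size x = i then Finsupp.lapply (T.gen l x (w ∘ Fin.cast h)) else 0

variable {i : ℕ}

theorem slice_apply_of_eq (l : ι → Bool) (w : Fin i → Bool) (z : C.Total) {x : K.Gen}
    (h : T.size x = i) : T.slice i l w z x = z (T.gen l x (w ∘ Fin.cast h)) := by
  simp [slice, h]

theorem slice_apply_of_ne (l : ι → Bool) (w : Fin i → Bool) (z : C.Total) {x : K.Gen}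
    (h : T.size x ≠ i) : T.slice i l w z x = 0 := by
  simp [slice, h]

theorem rCoeff_comp_cast {h h' : ℕ} (e : h = i) (e' : h' = i + 1) (u : Fin i → Bool)
    (w : Fin (i + 1) → Bool) :
    Fatgraph.rCoeff (u ∘ Fin.cast e) (w ∘ Fin.cast e') = rDeltaCoeff i u w := by
  subst e e'
  exact dif_pos rfl

theorem rPowDeg_comp_cast {h : ℕ} (e : h = i) (w : Fin i → Bool) :
    rPowDeg (w ∘ Fin.cast e) = rPowDeg w := by
  subst e
  rfl

/-- This is the formula `1 ⊗ d ⊗ Δ̄` read off at the basis element `l ⊗ w`. -/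
theorem slice_d (l : ι → Bool) (w : Fin (i + 1) → Bool) (z : C.Total) :
    T.slice (i + 1) l w (C.d z) = ∑ u, rDeltaCoeff i u w • K.d (T.slice i l u z) := by
  classical
  have := Fintype.ofFinite C.Gen
  have := Fintype.ofFinite K.Gen
  ext x'
  rw [Finsupp.finsetSum_apply]
  simp only [Finsupp.smul_apply, BasedComplex.d_apply]
  by_cases hx' : T.size x' = i + 1
  · rw [slice_apply_of_eq _ _ _ _ hx', BasedComplex.d_apply]
    -- Only generators over the same `l` and of size `i` can have a nonzero coefficient at the
    -- target; `e` enumerates them.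
    let e : (Fin i → Bool) × {x : K.Gen // T.size x = i} → C.Gen :=
      fun p => T.gen l p.2.1 (p.1 ∘ Fin.cast p.2.2)
    have he : Function.Injective e := by
      rintro ⟨u, x, hx⟩ ⟨u', x', hx'⟩ h
      have h2 := (T.gen_injective h).2
      obtain rfl : x = x' := congrArg Sigma.fst h2
      have h3 : u ∘ Fin.cast hx = u' ∘ Fin.cast hx := eq_of_heq (Sigma.mk.inj h2).2
      have h4 : u = u' := by
        subst hx
        exact h3
      rw [h4]
    rw [← Fintype.sum_of_injective e he
      (fun p => rDeltaCoeff i p.1 w * (T.slice i l p.1 z p.2.1 * K.coeff p.2.1 x')),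
      Fintype.sum_prod_type]
    · refine Finset.sum_congr rfl fun u _ => ?_
      rw [smul_eq_mul, Finset.mul_sum]
      refine Fintype.sum_of_injective Subtype.val Subtype.val_injective _ _ (fun x hx => ?_)
        fun _ => rfl
      rw [slice_apply_of_ne _ _ _ _ fun h => hx ⟨⟨x, h⟩, rfl⟩, zero_mul, mul_zero]
    · intro y hy
      obtain ⟨l', x, u, rfl⟩ := T.gen_surjective y
      by_cases hl : l' = l
      · subst hl
        rw [T.coeff_gen_self]
        by_cases hc : K.coeff x x' = 0
        · rw [hc, zero_mul, mul_zero]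
        · have h1 : T.size x = i := by
            have := T.size_eq_of_coeff_ne_zero _ _ hc
            omega
          refine absurd ⟨⟨u ∘ Fin.cast h1.symm, ⟨x, h1⟩⟩, ?_⟩ hy
          rfl
      · rw [T.coeff_gen_of_ne _ _ _ _ _ _ hl, mul_zero]
    · rintro ⟨u, x, hx⟩
      simp only [e]
      rw [T.coeff_gen_self, slice_apply_of_eq _ _ _ _ hx, rCoeff_comp_cast]
      ring
  · rw [slice_apply_of_ne _ _ _ _ hx']
    symm
    refine Finset.sum_eq_zero fun u _ => ?_
    rw [smul_eq_mul, Finset.sum_eq_zero, mul_zero]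
    intro x _
    by_cases hx : T.size x = i
    · by_cases hc : K.coeff x x' = 0
      · rw [hc, mul_zero]
      · exact absurd ((T.size_eq_of_coeff_ne_zero _ _ hc).trans (by rw [hx])) hx'
    · rw [slice_apply_of_ne _ _ _ _ hx, zero_mul]

theorem slice_mem_part {j : ℤ} {z : C.Total} (hz : z ∈ C.part i j) (l : ι → Bool)
    (w : Fin i → Bool) : T.slice i l w z ∈ K.part i (j - vPowDeg l - rPowDeg w) := by
  rw [BasedComplex.mem_part_iff] at hz ⊢
  intro x hx
  by_cases h : T.size x = i
  · rw [slice_apply_of_eq _ _ _ _ h] at hx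
    have := (hz _ hx).2
    rw [T.deg_gen, rPowDeg_comp_cast] at this
    refine ⟨by rw [T.height_eq, h], by omega⟩
  · exact absurd (slice_apply_of_ne _ _ _ _ h) hx

theorem eq_zero_of_slice_eq_zero {z : C.Total} (hz : ∀ y, z y ≠ 0 → C.height y = i)
    (h : ∀ l w, T.slice i l w z = 0) : z = 0 := by
  ext y
  by_contra hy
  obtain ⟨l, x, u, rfl⟩ := T.gen_surjective y
  have h1 : T.size x = i := by
    have := hz _ hy
    rw [T.height_gen] at this
    exact_mod_cast this
  refine hy ?_
  have h2 := DFunLike.congr_fun (h l (u ∘ Fin.cast h1.symm)) x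
  rw [slice_apply_of_eq _ _ _ _ h1] at h2
  exact h2

/-- The slices of a chain are independent of each other: any family of the right height and degrees
can be assembled. -/
theorem exists_slice_eq {j : ℤ} (f : (ι → Bool) → (Fin i → Bool) → K.Total)
    (hf : ∀ l w, f l w ∈ K.part i (j - vPowDeg l - rPowDeg w)) :
    ∃ z ∈ C.part i j, ∀ l w, T.slice i l w z = f l w := by
  choose L X U hgen using T.gen_surjective
  let g : (ι → Bool) → (Σ x, Fin (T.size x) → Bool) → ℤ := fun l p =>
    if h : T.size p.1 = i then f l (p.2 ∘ Fin.cast h.symm) p.1 else 0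
  let z : C.Total := Finsupp.equivFunOnFinite.symm fun y => g (L y) ⟨X y, U y⟩
  have hz : ∀ l x u, z (T.gen l x u) = g l ⟨x, u⟩ := by
    intro l x u
    have := T.gen_injective (hgen (T.gen l x u))
    change g _ _ = _
    rw [this.1, this.2]
  refine ⟨z, (C.mem_part_iff).2 fun y hy => ?_, fun l w => ?_⟩
  · obtain ⟨l, x, u, rfl⟩ := T.gen_surjective y
    rw [hz] at hy
    by_cases h : T.size x = i
    · have h1 : g l ⟨x, u⟩ = f l (u ∘ Fin.cast h.symm) x := dif_pos h
      rw [h1] at hy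
      have h2 := (K.mem_part_iff.1 (hf _ _) _ hy).2
      rw [rPowDeg_comp_cast] at h2
      rw [T.height_gen, T.deg_gen]
      exact ⟨congrArg _ h, by omega⟩
    · exact absurd (dif_neg h) hy
  · ext x
    by_cases h : T.size x = i
    · rw [slice_apply_of_eq _ _ _ _ h, hz]
      exact dif_pos h
    · rw [slice_apply_of_ne _ _ _ _ h]
      by_contra h2
      have h3 := (K.mem_part_iff.1 (hf _ _) _ (Ne.symm h2)).1
      rw [T.height_eq] at h3
      exact h (by exact_mod_cast h3)

/-! ### Cycles and boundaries of a twisted complex -/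

theorem height_eq_of_d_apply_ne_zero (T : RTwist K C ι) {z : C.Total}
    (hz : ∀ y, z y ≠ 0 → C.height y = i) (y : C.Gen) (hy : C.d z y ≠ 0) : C.height y = (i + 1 : ℕ) := by
  have := Fintype.ofFinite C.Gen
  rw [BasedComplex.d_apply] at hy
  obtain ⟨y', -, h⟩ := Finset.exists_ne_zero_of_sum_ne_zero hy
  have h1 := hz _ (left_ne_zero_of_mul h)
  have h2 := right_ne_zero_of_mul h
  obtain ⟨l, x, u, rfl⟩ := T.gen_surjective y
  obtain ⟨l', x', u', rfl⟩ := T.gen_surjective y'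
  by_cases hl : l' = l
  · subst hl
    rw [T.coeff_gen_self] at h2
    rw [T.height_gen] at h1 ⊢
    rw [T.size_eq_of_coeff_ne_zero _ _ (left_ne_zero_of_mul h2)]
    push_cast
    rw [h1]
  · exact absurd (T.coeff_gen_of_ne _ _ _ _ _ _ hl) h2

/-- Since `Δ̄` is injective with an identity block, the slice of `C.d z` at the word `u` with `x₀`
inserted is exactly `K.d` of the slice of `z` at `u`. -/
theorem d_eq_zero_iff {z : C.Total} (hz : ∀ y, z y ≠ 0 → C.height y = i) :
    C.d z = 0 ↔ ∀ l w, K.d (T.slice i l w z) = 0 := by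
  constructor
  · intro h l u
    have h1 := T.slice_d (i := i) l ((deltaPos i).insertNth (α := fun _ => Bool) true u) z
    rw [h, map_zero] at h1
    simpa [rDeltaCoeff_insertNth, ite_smul] using h1.symm
  · intro h
    refine T.eq_zero_of_slice_eq_zero (T.height_eq_of_d_apply_ne_zero hz) fun l w => ?_
    rw [slice_d]
    simp [h]

theorem mem_cycles_iff {j : ℤ} {z : C.Total} (hz : z ∈ C.part i j) :
    z ∈ C.cycles i j ↔ ∀ l w, T.slice i l w z ∈ K.cycles i (j - vPowDeg l - rPowDeg w) := by
  have h1 := T.d_eq_zero_iff fun y hy => (C.mem_part_iff.1 hz y hy).1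
  constructor
  · intro h l w
    exact ⟨h1.1 h.1 l w, T.slice_mem_part hz l w⟩
  · intro h
    exact ⟨h1.2 fun l w => (h l w).1, hz⟩

/-- The boundaries of a twisted complex in terms of a splitting of the words. -/
def HasBoundaries (W : WordSplitting i) : Prop :=
  ∀ (j : ℤ) (z : C.Total), z ∈ C.boundaries i j ↔ (∀ y, z y ≠ 0 → C.height y = i) ∧
    ∃ g : (ι → Bool) → W.Src → K.Total,
      (∀ l v, g l v ∈ K.boundaries i (j - vPowDeg l - rPowDeg (W.word (Sum.inl v)))) ∧
      ∀ l w, T.slice i l w z = ∑ v, W.delta v w • g l v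

theorem hasBoundaries_zero : T.HasBoundaries WordSplitting.zero := by
  intro j z
  have hb : C.boundaries (0 : ℕ) j = ⊥ := by
    refine (Submodule.eq_bot_iff _).2 ?_
    rintro _ ⟨y, hy, rfl⟩
    suffices y = 0 by rw [this, map_zero]
    ext x
    by_contra hx
    have h1 := (C.mem_part_iff.1 hy x hx).1
    obtain ⟨l, x, u, rfl⟩ := T.gen_surjective x
    rw [T.height_gen] at h1
    omega
  have : IsEmpty WordSplitting.zero.Src := inferInstanceAs (IsEmpty Empty)
  rw [hb, Submodule.mem_bot]
  constructor
  · rintro rfl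
    exact ⟨by simp, fun _ v => v.elim, fun _ v => v.elim, fun l w => by simp⟩
  · rintro ⟨h1, g, -, h2⟩
    exact T.eq_zero_of_slice_eq_zero h1 fun l w => by simp [h2]

/-- By `slice_d`, a boundary is a combination of the columns of `Δ̄` with boundaries of `K` as
coefficients. Conversely, primitives of the coefficients are the slices of a primitive of the whole.
-/
theorem hasBoundaries_succ (h : ℕ) : T.HasBoundaries (WordSplitting.succ h) := by
  intro j z
  have hh : ((h + 1 : ℕ) : ℤ) - 1 = (h : ℕ) := by push_cast; ring
  have hdeg : ∀ v, rPowDeg ((WordSplitting.succ h).word (Sum.inl v)) = rPowDeg v :=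
    rPowDeg_insertNth_true
  simp only [BasedComplex.boundaries, hh, hdeg]
  constructor
  · rintro ⟨y, hy, rfl⟩
    refine ⟨T.height_eq_of_d_apply_ne_zero fun x hx => (C.mem_part_iff.1 hy x hx).1,
      fun l v => K.d (T.slice h l v y), fun l v => ⟨_, T.slice_mem_part hy l v, rfl⟩,
      fun l w => T.slice_d l w y⟩
  · rintro ⟨hz, g, hg, hgz⟩
    choose f hf hfg using hg
    obtain ⟨y, hy, hyf⟩ := T.exists_slice_eq f hf
    refine ⟨y, hy, sub_eq_zero.1 (T.eq_zero_of_slice_eq_zero (i := h + 1) ?_ fun l w => ?_)⟩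
    · intro x hx
      by_contra hne
      have h1 : C.d y x = 0 := by
        by_contra h1
        exact hne (T.height_eq_of_d_apply_ne_zero (fun x hx => (C.mem_part_iff.1 hy x hx).1) x h1)
      have h2 : z x = 0 := by
        by_contra h2
        exact hne (hz x h2)
      exact hx (by rw [Finsupp.sub_apply, h1, h2, sub_self])
    · rw [map_sub, hgz, slice_d, sub_eq_zero]
      refine Finset.sum_congr rfl fun v _ => ?_
      rw [hyf]
      exact congrArg (fun m => rDeltaCoeff h v w • m) (hfg l v)

end RTwist

/-! ### The homology of a twisted complex -/

/-- A direct sum in which almost all summands vanish is a product. -/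
theorem nonempty_directSum_equiv_pi {R T : Type*} [CommRing R] {X : T → Type*}
    [∀ t, AddCommGroup (X t)] [∀ t, Module R (X t)] {s : Set T} (hs : s.Finite)
    (h : ∀ t ∉ s, Subsingleton (X t)) : Nonempty ((⨁ t, X t) ≃ₗ[R] ∀ t, X t) := by
  classical
  refine ⟨LinearEquiv.ofBijective (DirectSum.coeFnLinearMap R) ⟨?_, fun x => ?_⟩⟩
  · exact DFunLike.coe_injective
  · refine ⟨DFinsupp.mk hs.toFinset fun t => x t, ?_⟩
    funext t
    rw [DirectSum.coeFnLinearMap_apply]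
    by_cases ht : t ∈ s
    · exact (DFinsupp.mk_apply).trans (dif_pos (hs.mem_toFinset.2 ht))
    · have := h t ht
      exact Subsingleton.elim _ _

theorem vPart_nonempty_equiv (ι : Type*) [Finite ι] (r : ℤ) :
    Nonempty (vPart ι r ≃ₗ[ℤ] ({l : ι → Bool // vPowDeg l = r} → ℤ)) :=
  ⟨(Finsupp.supportedEquivFinsupp _).trans (Finsupp.linearEquivFunOnFinite ℤ ℤ _)⟩

namespace RTwist

variable {K C : BasedComplex} {ι : Type*} (T : RTwist K C ι) {i : ℕ} (W : WordSplitting i)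

/-- The component of the chains of height `i` at `l` and a word in the complement of the image of
`Δ̄`. -/
def residue (l : ι → Bool) (c : W.Compl) : C.Total →ₗ[ℤ] K.Total :=
  T.slice i l (W.word (Sum.inr c)) -
    ∑ v, W.delta v (W.word (Sum.inr c)) • T.slice i l (W.word (Sum.inl v))

theorem residue_apply (l : ι → Bool) (c : W.Compl) (z : C.Total) :
    T.residue W l c z = W.residue (fun w => T.slice i l w z) c := by
  simp [residue, WordSplitting.residue]

theorem slice_mem_cycles {j p r : ℤ} {l : ι → Bool} (hl : vPowDeg l = r) {w : Fin i → Bool} {q : ℤ}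
    (hw : rPowDeg w = q) (h : p + q + r = j) {z : C.Total} (hz : z ∈ C.cycles i j) :
    T.slice i l w z ∈ K.cycles i p := by
  obtain rfl : p = j - vPowDeg l - rPowDeg w := by omega
  exact (T.mem_cycles_iff hz.2).1 hz l w

theorem residue_mem_cycles {j p r : ℤ} {l : ι → Bool} (hl : vPowDeg l = r) {c : W.Compl} {q : ℤ}
    (hc : rPowDeg (W.word (Sum.inr c)) = q) (h : p + q + r = j) {z : C.Total}
    (hz : z ∈ C.cycles i j) : T.residue W l c z ∈ K.cycles i p := by
  obtain rfl : p = j - vPowDeg l - rPowDeg (W.word (Sum.inr c)) := by omega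
  rw [residue_apply]
  exact W.residue_mem (fun r => K.cycles i (j - vPowDeg l - r)) ((T.mem_cycles_iff hz.2).1 hz l) c

/-- The summand of the homology of a twisted complex of degrees `p`, `q` and `r`, in coordinates. -/
abbrev Summand (K : BasedComplex) (ι : Type*) (W : WordSplitting i) (p q r : ℤ) : Type _ :=
  {l : ι → Bool // vPowDeg l = r} →
    (W.SrcOfDeg q → K.Homology i p) × (W.ComplOfDeg q → K.cycles i p)

/-- The coordinates of the class of a cycle. -/
def coordinates (j : ℤ) : C.cycles i j →ₗ[ℤ]
    ∀ t : {t : ℤ × ℤ × ℤ // t.1 + t.2.1 + t.2.2 = j}, Summand K ι W t.1.1 t.1.2.1 t.1.2.2 :=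
  LinearMap.pi fun t => LinearMap.pi fun l => LinearMap.prod
    (LinearMap.pi fun u => Submodule.mkQ _ ∘ₗ
      ((T.slice i l.1 (W.word (Sum.inl u.1))).restrict
        fun _ hz => T.slice_mem_cycles l.2 u.2 t.2 hz))
    (LinearMap.pi fun c => (T.residue W l.1 c.1).restrict
      fun _ hz => T.residue_mem_cycles W l.2 c.2 t.2 hz)

/-- Homology classes are lifted to cycles of `K`, which become the slices at the source words; the
given cycles become the residues. All slices are then cycles, and so is the assembled chain. -/
theorem coordinates_surjective (j : ℤ) : Function.Surjective (T.coordinates W j) := by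
  intro x
  choose a ha using fun (l : ι → Bool) (u : W.Src) =>
    Submodule.mkQ_surjective _ ((x ⟨⟨j - vPowDeg l - rPowDeg (W.word (Sum.inl u)),
      rPowDeg (W.word (Sum.inl u)), vPowDeg l⟩, by ring⟩ ⟨l, rfl⟩).1 ⟨u, rfl⟩)
  let b : ∀ (l : ι → Bool) (c : W.Compl),
      K.cycles i (j - vPowDeg l - rPowDeg (W.word (Sum.inr c))) := fun l c =>
    (x ⟨⟨j - vPowDeg l - rPowDeg (W.word (Sum.inr c)), rPowDeg (W.word (Sum.inr c)), vPowDeg l⟩,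
      by ring⟩ ⟨l, rfl⟩).2 ⟨c, rfl⟩
  choose f hf hfa hfb using fun l : ι → Bool => W.exists_of_residue
    (fun r => K.cycles i (j - vPowDeg l - r)) (fun u => (a l u).1) (fun c => (b l c).1)
    (fun u => (a l u).2) (fun c => (b l c).2)
  obtain ⟨z, hz, hzf⟩ := T.exists_slice_eq f fun l w => (hf l w).2
  have hzc : z ∈ C.cycles i j := by
    rw [T.mem_cycles_iff hz]
    intro l w
    rw [hzf]
    exact hf l w
  refine ⟨⟨z, hzc⟩, ?_⟩
  funext ⟨⟨p, q, r⟩, ht⟩ ⟨l, hl⟩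
  dsimp only at hl ht ⊢
  subst hl
  refine Prod.ext (funext fun ⟨u, hu⟩ => ?_) (funext fun ⟨c, hc⟩ => ?_)
  · dsimp only at hu
    subst hu
    obtain rfl : p = j - vPowDeg l - rPowDeg (W.word (Sum.inl u)) := by omega
    rw [← ha]
    refine congrArg (Submodule.mkQ _) (Subtype.ext ?_)
    exact (hzf l _).trans (hfa l u)
  · dsimp only at hc
    subst hc
    obtain rfl : p = j - vPowDeg l - rPowDeg (W.word (Sum.inr c)) := by omega
    refine Subtype.ext ((T.residue_apply W l c z).trans ?_)
    have : (fun w => T.slice i l w z) = f l := funext (hzf l)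
    rw [this]
    exact hfb l c

variable {W}

/-- By `eq_sum_delta_iff`, a cycle is a boundary exactly when its residues vanish and its slices at
the source words are boundaries of `K`. -/
theorem ker_coordinates (hW : T.HasBoundaries W) (j : ℤ) :
    (C.boundaries i j).submoduleOf (C.cycles i j) = LinearMap.ker (T.coordinates W j) := by
  ext ⟨z, hz⟩
  rw [LinearMap.mem_ker]
  change z ∈ C.boundaries i j ↔ _
  rw [hW]
  constructor
  · rintro ⟨-, g, hg, hzg⟩
    funext ⟨⟨p, q, r⟩, ht⟩ ⟨l, hl⟩
    dsimp only at hl ht ⊢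
    subst hl
    have key := (W.eq_sum_delta_iff (fun w => T.slice i l w z) (g l)).1 (hzg l)
    refine Prod.ext (funext fun ⟨u, hu⟩ => ?_) (funext fun ⟨c, hc⟩ => ?_)
    · dsimp only at hu
      subst hu
      obtain rfl : p = j - vPowDeg l - rPowDeg (W.word (Sum.inl u)) := by omega
      refine (Submodule.Quotient.mk_eq_zero _).2 ?_
      change T.slice i l (W.word (Sum.inl u)) z ∈ K.boundaries _ _
      rw [key.1 u]
      exact hg l u
    · exact Subtype.ext ((T.residue_apply W l c z).trans (key.2 c))
  · intro h
    refine ⟨fun y hy => (C.mem_part_iff.1 hz.2 y hy).1,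
      fun l u => T.slice i l (W.word (Sum.inl u)) z, fun l u => ?_,
      fun l => (W.eq_sum_delta_iff (fun w => T.slice i l w z) _).2 ⟨fun _ => rfl, fun c => ?_⟩⟩
    · have h1 := congrFun (congrArg Prod.fst (congrFun (congrFun h
        ⟨⟨j - vPowDeg l - rPowDeg (W.word (Sum.inl u)), rPowDeg (W.word (Sum.inl u)), vPowDeg l⟩,
          by ring⟩) ⟨l, rfl⟩)) ⟨u, rfl⟩
      exact (Submodule.Quotient.mk_eq_zero (Submodule.submoduleOf _ (K.cycles _ _))).1 h1
    · have h1 := congrFun (congrArg Prod.snd (congrFun (congrFun h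
        ⟨⟨j - vPowDeg l - rPowDeg (W.word (Sum.inr c)), rPowDeg (W.word (Sum.inr c)), vPowDeg l⟩,
          by ring⟩) ⟨l, rfl⟩)) ⟨c, rfl⟩
      rw [← T.residue_apply]
      exact congrArg Subtype.val h1

theorem nonempty_summand_equiv [Finite ι] (K : BasedComplex) (W : WordSplitting i) (p q r : ℤ) :
    Nonempty (Summand K ι W p q r ≃ₗ[ℤ]
      ((K.Homology i p ⊗[ℤ] rDeltaImage i q) × (K.cycles i p ⊗[ℤ] RQuot i q)) ⊗[ℤ] vPart ι r) := by
  classical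
  obtain ⟨e₁⟩ := W.nonempty_rDeltaImage_equiv q
  obtain ⟨e₂⟩ := W.nonempty_rQuot_equiv q
  obtain ⟨e₃⟩ := vPart_nonempty_equiv ι r
  have := Fintype.ofFinite {l : ι → Bool // vPowDeg l = r}
  exact ⟨((TensorProduct.congr (LinearEquiv.prodCongr
    ((TensorProduct.congr (LinearEquiv.refl ℤ _) e₁).trans (TensorProduct.piScalarRight ℤ ℤ _ _))
    ((TensorProduct.congr (LinearEquiv.refl ℤ _) e₂).trans (TensorProduct.piScalarRight ℤ ℤ _ _)))
    e₃).trans (TensorProduct.piScalarRight ℤ ℤ _ _)).symm⟩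

theorem nonempty_homology_equiv [Finite ι] (hW : T.HasBoundaries W) (j : ℤ) :
    Nonempty (C.Homology i j ≃ₗ[ℤ]
      ⨁ t : {t : ℤ × ℤ × ℤ // t.1 + t.2.1 + t.2.2 = j},
        ((K.Homology i t.1.1 ⊗[ℤ] rDeltaImage i t.1.2.1) ×
          (K.cycles i t.1.1 ⊗[ℤ] RQuot i t.1.2.1)) ⊗[ℤ] vPart ι t.1.2.2) := by
  have e₁ := (Submodule.quotEquivOfEq _ _ (T.ker_coordinates hW j)).trans
    ((T.coordinates W j).quotKerEquivOfSurjective (T.coordinates_surjective W j))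
  obtain ⟨e₂⟩ := nonempty_directSum_equiv_pi (R := ℤ)
    (X := fun t : {t : ℤ × ℤ × ℤ // t.1 + t.2.1 + t.2.2 = j} =>
      Summand K ι W t.1.1 t.1.2.1 t.1.2.2)
    -- Only triples of degrees realised by a pair of basis words have a nonzero summand; for the
    -- others the index types of the coordinates are empty.
    (Set.finite_range fun p : (ι → Bool) × (Fin i → Bool) =>
      (⟨⟨j - vPowDeg p.1 - rPowDeg p.2, rPowDeg p.2, vPowDeg p.1⟩, by ring⟩ :
        {t : ℤ × ℤ × ℤ // t.1 + t.2.1 + t.2.2 = j})) (by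
    rintro ⟨⟨p, q, r⟩, ht⟩ hns
    dsimp only at ht
    have hne : ∀ l : ι → Bool, vPowDeg l = r → ∀ w : Fin i → Bool, rPowDeg w ≠ q := by
      rintro l rfl w rfl
      exact hns ⟨(l, w), Subtype.ext (Prod.ext (by dsimp only; omega) rfl)⟩
    refine ⟨fun x y => funext fun ⟨l, hl⟩ => Prod.ext (funext fun ⟨u, hu⟩ => ?_)
      (funext fun ⟨c, hc⟩ => ?_)⟩
    · exact absurd hu (hne l hl _)
    · exact absurd hc (hne l hl _))
  exact ⟨(e₁.trans e₂.symm).trans (DFinsupp.mapRange.linearEquiv fun t =>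
    (nonempty_summand_equiv K W t.1.1 t.1.2.1 t.1.2.2).some)⟩

end RTwist

/-! ### Shifts -/

namespace BasedComplex

variable (C : BasedComplex) {s l i j i' j' : ℤ}

theorem part_shift (hi : i' = i + s) (hj : j' = j + l) :
    (C.shift s l).part i' j' = C.part i j := by
  subst hi hj
  refine congrArg (Finsupp.supported ℤ ℤ) (Set.ext fun x => ?_)
  exact and_congr (add_left_inj s) (add_left_inj l)

theorem cycles_shift (hi : i' = i + s) (hj : j' = j + l) :
    (C.shift s l).cycles i' j' = C.cycles i j :=
  congrArg (LinearMap.ker C.d ⊓ ·) (C.part_shift hi hj)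

theorem boundaries_shift (hi : i' = i + s) (hj : j' = j + l) :
    (C.shift s l).boundaries i' j' = C.boundaries i j :=
  congrArg (Submodule.map C.d) (C.part_shift (by rw [hi]; ring) hj)

theorem nonempty_quotient_equiv_of_eq {R M : Type*} [Ring R] [AddCommGroup M] [Module R M]
    {Z Z' B B' : Submodule R M} (hZ : Z = Z') (hB : B = B') :
    Nonempty ((Z ⧸ B.submoduleOf Z) ≃ₗ[R] (Z' ⧸ B'.submoduleOf Z')) := by
  subst hZ hB
  exact ⟨LinearEquiv.refl R _⟩

theorem nonempty_homology_shift_equiv (hi : i' = i + s) (hj : j' = j + l) :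
    Nonempty ((C.shift s l).Homology i' j' ≃ₗ[ℤ] C.Homology i j) :=
  nonempty_quotient_equiv_of_eq (C.cycles_shift hi hj) (C.boundaries_shift hi hj)

end BasedComplex

end

/-! ### The theorem -/

theorem theorem6p2 {V E : Type*} [Finite V] [Fintype E] [LinearOrder E] (F : Fatgraph V E)
    (hF : F.IsGenusZero) :
    -- the homology of the unnormalised chromatic complex
    (∀ (i : ℕ) (j : ℤ),
      Nonempty (F.chromaticComplexTilde.Homology i j ≃ₗ[ℤ]
        ⨁ t : {t : ℤ × ℤ × ℤ // t.1 + t.2.1 + t.2.2 = j},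
          (((F.assocLink hF).khovanovComplexTilde.Homology i t.1.1 ⊗[ℤ] rDeltaImage i t.1.2.1) ×
            ((F.assocLink hF).khovanovComplexTilde.cycles i t.1.1 ⊗[ℤ] RQuot i t.1.2.1)) ⊗[ℤ]
          vPart V t.1.2.2)) ∧
    -- the groups above in terms of Khovanov homology, for every orientation of the link
    (∀ (o : (F.assocLink hF).Orientation) (i p : ℤ),
      Nonempty ((F.assocLink hF).khovanovComplexTilde.Homology i p ≃ₗ[ℤ]
        ((F.assocLink hF).khovanovComplex o).Homology (i - o.nNeg) (p + o.nPos - 2 * o.nNeg)) ∧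
      ((F.assocLink hF).khovanovComplex o).cycles (i - o.nNeg) (p + o.nPos - 2 * o.nNeg) =
        (F.assocLink hF).khovanovComplexTilde.cycles i p) ∧
    -- the homology of the normalised chromatic complex
    (∀ i j : ℤ,
      Nonempty (F.chromaticComplex.Homology i j ≃ₗ[ℤ]
        F.chromaticComplexTilde.Homology (i + Fintype.card E) j)) := by
  refine ⟨fun i j => ?_, fun o i p => ⟨?_, ?_⟩, fun i j => ?_⟩
  -- In height zero nothing is split off from `R^{⊗0}`; in positive height the words with an
  -- inserted `x₀` are.
  · cases i with
    | zero => exact (F.rTwist hF).nonempty_homology_equiv (F.rTwist hF).hasBoundaries_zero j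
    | succ h => exact (F.rTwist hF).nonempty_homology_equiv ((F.rTwist hF).hasBoundaries_succ h) j
  · exact ((F.assocLink hF).khovanovComplexTilde.nonempty_homology_shift_equiv
      (by ring) (by ring)).map LinearEquiv.symm
  · exact (F.assocLink hF).khovanovComplexTilde.cycles_shift (by ring) (by ring)
  · exact F.chromaticComplexTilde.nonempty_homology_shift_equiv (by ring) (by ring)
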